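/- There is a universal constant $C>0$ such that the following holds. Let $N\ge 1$, $n\ge 1$, let $Z_0\in M_N(\mathbb C)$ be a deterministic Hermitian matrix, let $Z_1,\dots,Z_n$ be independent random $N\times N$ complex matrices on a probability space that are almost surely Hermitian, have integrable entries and satisfy $\mathbb E[Z_k]=0$, and assume that they are not all almost surely equal to $0$ (equivalently, that $X$ below is not almost surely deterministic). Put $$X:=Z_0+\sum_{k=1}^n Z_k .$$ Write $\|\cdot\|$ for the operator norm and set $$\sigma(X)^2:=\min\Big(\big\|\mathbb E[(X-\mathbb EX)^*(X-\mathbb EX)]\big\|,\ \big\|\mathbb E[(X-\mathbb EX)(X-\mathbb EX)^*]\big\|\Big),\qquad R(X):=\Big\|\max_{1\le k\le n}\|Z_k\|\Big\|_{L^\infty}\in[0,\infty]$$ (the two norms in the minimum coincide because $X$ is Hermitian). Then for every $z\in\mathbb C$ with $\operatorname{Im}z>0$, all $u,v\in\mathbb R^N$ with Euclidean norm $\|u\|=\|v\|=1$, and every $x\ge 0$, $$\mathbb P\Big[\big|\langle u,(z\mathbf 1-X)^{-1}v\rangle-\mathbb E\langle u,(z\mathbf 1-X)^{-1}v\rangle\big|\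 \ge\ t(x)\Big]\le 2e^{-Cx},$$ where $$t(x)=\frac{\sigma(X)}{(\operatorname{Im}z)^2}\sqrt x+\Big\{\frac{R(X)}{(\operatorname{Im}z)^2}+\frac{R(X)^2}{(\operatorname{Im}z)^3}\Big\}x+\Big\{\frac{R(X)^{1/2}\,(\mathbb E\|X-\mathbb EX\|)^{1/2}}{(\operatorname{Im}z)^2}+\frac{R(X)\,(\mathbb E[\|X-\mathbb EX\|^2])^{1/2}}{(\operatorname{Im}z)^3}\Big\}\sqrt x .$$ If $R(X)=\infty$, then $t(x)=\infty$ for $x>0$ and the claim is trivial. -/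

import Mathlib

open MeasureTheory ProbabilityTheory
open scoped ENNReal Matrix.Norms.L2Operator

/-! Throughout, `‖A‖` for a matrix `A` is the operator norm on `ℓ²` (the scoped norm
opened above), and `‖A‖ₑ` is the same number in `[0, ∞]`. -/

namespace RandomMatrix

/-- The product (entrywise Borel) σ-algebra on `N × N` complex matrices. -/
noncomputable instance matrixMeasurableSpace {N : ℕ} : MeasurableSpace (Matrix (Fin N) (Fin N) ℂ) :=
  (MeasurableSpace.pi : MeasurableSpace (Fin N → Fin N → ℂ))

/-- The (entrywise) expectation `E[X]` of a random matrix. -/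
noncomputable def expect {Ω : Type*} [MeasurableSpace Ω] (P : Measure Ω) {N : ℕ}
    (X : Ω → Matrix (Fin N) (Fin N) ℂ) : Matrix (Fin N) (Fin N) ℂ :=
  Matrix.of fun i j => ∫ ω, X ω i j ∂P

/-- The centred random matrix `X - E[X]`. -/
noncomputable def centered {Ω : Type*} [MeasurableSpace Ω] (P : Measure Ω) {N : ℕ}
    (X : Ω → Matrix (Fin N) (Fin N) ℂ) (ω : Ω) : Matrix (Fin N) (Fin N) ℂ :=
  X ω - expect P X

/-- The random matrix `X = Z₀ + ∑ₖ Zₖ`. -/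
def model {Ω : Type*} {N n : ℕ} (Z₀ : Matrix (Fin N) (Fin N) ℂ)
    (Z : Fin n → Ω → Matrix (Fin N) (Fin N) ℂ) (ω : Ω) : Matrix (Fin N) (Fin N) ℂ :=
  Z₀ + ∑ k, Z k ω

/-- `σ(X) = (‖E[(X - EX)* (X - EX)]‖ ∧ ‖E[(X - EX) (X - EX)*]‖)^{1/2}`; for a Hermitian `X`
the two norms coincide. -/
noncomputable def sigma {Ω : Type*} [MeasurableSpace Ω] (P : Measure Ω) {N : ℕ}
    (X : Ω → Matrix (Fin N) (Fin N) ℂ) : ℝ :=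
  Real.sqrt (min
    ‖expect P fun ω => Matrix.conjTranspose (centered P X ω) * centered P X ω‖
    ‖expect P fun ω => centered P X ω * Matrix.conjTranspose (centered P X ω)‖)

/-- `R(X)`, the essential supremum of `maxₖ ‖Zₖ‖`; it is `∞` if the `Zₖ` are unbounded. -/
noncomputable def R {Ω : Type*} [MeasurableSpace Ω] (P : Measure Ω) {N n : ℕ}
    (Z : Fin n → Ω → Matrix (Fin N) (Fin N) ℂ) : ℝ≥0∞ :=
  essSup (fun ω => ⨆ k, ‖Z k ω‖ₑ) P

/-- `E[‖X - EX‖ ^ p]` for the operator norm. -/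
noncomputable def normMoment {Ω : Type*} [MeasurableSpace Ω] (P : Measure Ω) {N : ℕ}
    (X : Ω → Matrix (Fin N) (Fin N) ℂ) (p : ℕ) : ℝ≥0∞ :=
  ∫⁻ ω, ‖centered P X ω‖ₑ ^ p ∂P

/-- The bilinear resolvent entry `⟨u, (z - A)⁻¹ v⟩` for real vectors `u, v`. -/
noncomputable def resolventEntry {N : ℕ} (u v : EuclideanSpace ℝ (Fin N)) (z : ℂ)
    (A : Matrix (Fin N) (Fin N) ℂ) : ℂ :=
  ∑ i, ∑ j, (u i : ℂ) * (z • (1 : Matrix (Fin N) (Fin N) ℂ) - A)⁻¹ i j * (v j : ℂ)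

/-- The deviation threshold, with `η = Im z`. It takes values in `[0, ∞]`: if `R(X) = ∞` and
`x > 0` it is `∞`, and otherwise every term is finite. -/
noncomputable def threshold {Ω : Type*} [MeasurableSpace Ω] (P : Measure Ω) {N n : ℕ}
    (Z₀ : Matrix (Fin N) (Fin N) ℂ) (Z : Fin n → Ω → Matrix (Fin N) (Fin N) ℂ)
    (η x : ℝ) : ℝ≥0∞ :=
  ENNReal.ofReal (sigma P (model Z₀ Z) / η ^ 2 * Real.sqrt x)
    + (R P Z / ENNReal.ofReal (η ^ 2) + R P Z ^ 2 / ENNReal.ofReal (η ^ 3)) * ENNReal.ofReal x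
    + (R P Z ^ (1 / 2 : ℝ) * normMoment P (model Z₀ Z) 1 ^ (1 / 2 : ℝ) / ENNReal.ofReal (η ^ 2)
        + R P Z * normMoment P (model Z₀ Z) 2 ^ (1 / 2 : ℝ) / ENNReal.ofReal (η ^ 3))
      * ENNReal.ofReal (Real.sqrt x)

end RandomMatrix

/-! The tail bound comes from high moments. For a function `f` of independent variables, the moment
form of the Efron–Stein inequality (`integral_pow_le_efronStein`) bounds the `2q`-th central moment
by `(2q-1)^q` times the `q`-th moment of the sum `V` of squared increments under resampling one
coordinate. It follows from an exact covariance formula (`integral_sub_mul_eq`): interpolate between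
the vector and an independent copy by exchanging coordinates, averaging over all orders of exchange.

For `f = Re⟨u, G v⟩` with `G = (z - X)⁻¹`, expand the resolvent to second order: a change `D` in one
summand contributes `Re⟨G* u, D G v⟩` and a remainder of size at most `‖D‖ ‖D G* u‖ / (Im z)²`. As
`‖G‖ ≤ 1 / Im z`, `V` is controlled by two suprema over the unit ball, `sup Σ (Re⟨a, Z_k b⟩)²` and
`sup Σ ‖Z_k a‖²` (`efronStein_resolvRe_le`). A supremum of sums of nonnegative terms is
self-bounding, so its `q`-th moment is at most `(mean + q R²)^q` (`integral_iSup_sum_pow_le`, again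
from the covariance formula).

The means are bounded by symmetrization. The sum of `‖Z_k a‖²` is an average over signs of squared
norms of signed sums, which gives `E‖X - EX‖²`. For the bilinear form, centring leaves the weak
variance `σ²`, and the contraction principle linearizes the squares at the price of a factor `R`,
which gives `R E‖X - EX‖` (`integral_iSup_sum_sq_le`).

Altogether the `2q`-th moment is at most `(512 t(q)²)^q` (`integral_resolvRe_pow_le`). Markov's
inequality with `q` proportional to `x` gives the tail, and a union bound over real and imaginary
parts gives the factor `2`. -/

namespace RandomMatrix

/-! ### Telescoping over the discrete cube -/

section Cube

open Finset
open scoped symmDiff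

/-- The weight of a vertex with `s` ones in the `n`-dimensional cube; a vertex chosen with these
weights has a uniformly distributed number of ones. -/
noncomputable def cubeWeight (n s : ℕ) : ℝ := ((n + 1 : ℝ) * n.choose s)⁻¹

lemma cubeWeight_nonneg (n s : ℕ) : 0 ≤ cubeWeight n s := by
  unfold cubeWeight; positivity

/-- An edge of the cube is counted from both endpoints, so its total weight is the sum of two vertex
weights. The identity says that this is the probability that a uniformly random monotone path from
`∅` to the top uses the edge. -/
lemma sub_mul_cubeWeight_add {n s : ℕ} (hs : s < n) :
    ((n : ℝ) - s) * (cubeWeight n s + cubeWeight n (s + 1)) = (n.choose s : ℝ)⁻¹ := by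
  have h1 : (n.choose (s + 1) : ℝ) * (s + 1) = n.choose s * (n - s) := by
    have := Nat.choose_succ_right_eq n s
    have h2 : ((n - s : ℕ) : ℝ) = (n : ℝ) - s := by push_cast [hs.le]; ring
    rw [← h2]; exact_mod_cast this
  have hc : (0 : ℝ) < n.choose s := by exact_mod_cast Nat.choose_pos hs.le
  have hc' : (0 : ℝ) < n.choose (s + 1) := by exact_mod_cast Nat.choose_pos hs
  have hns : (0 : ℝ) < (n : ℝ) - s := by
    have : (s : ℝ) < n := by exact_mod_cast hs
    linarith
  have h3 : (n.choose (s + 1) : ℝ)⁻¹ = (s + 1) / (n.choose s * (n - s)) := by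
    rw [← h1]; field_simp
  unfold cubeWeight
  rw [mul_inv, mul_inv, h3]
  field_simp
  ring

variable {ι : Type*} [Fintype ι] [DecidableEq ι]

omit [DecidableEq ι] in
lemma sum_cubeWeight : ∑ S : Finset ι, cubeWeight (Fintype.card ι) #S = 1 := by
  rw [← Finset.powerset_univ, Finset.sum_powerset_apply_card (cubeWeight (Fintype.card ι)),
    Finset.card_univ]
  have : ∀ m ∈ range (Fintype.card ι + 1),
      (Fintype.card ι).choose m • cubeWeight (Fintype.card ι) m = ((Fintype.card ι : ℝ) + 1)⁻¹ := by
    intro m hm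
    have hc : (0 : ℝ) < (Fintype.card ι).choose m := by
      exact_mod_cast Nat.choose_pos (by simpa [Nat.lt_succ_iff] using hm)
    unfold cubeWeight
    rw [nsmul_eq_mul]
    field_simp
  rw [Finset.sum_congr rfl this]
  simp
  field_simp

/-- The orientation of the cube edge from `S` in direction `k`. -/
def cubeSign (S : Finset ι) (k : ι) : ℝ := if k ∈ S then -1 else 1

omit [Fintype ι] in
lemma abs_cubeSign (S : Finset ι) (k : ι) : |cubeSign S k| = 1 := by
  unfold cubeSign; split_ifs <;> simp

/-- The signed edge weights form a unit flow from `∅` to `univ`. At a vertex of size `s` the inflow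
from smaller sets and the outflow to larger sets are both `1 / n.choose s`, except that `∅` has no
inflow and `univ` no outflow. -/
lemma cube_divergence (S : Finset ι) :
    ∑ k, (cubeWeight (Fintype.card ι) #S * cubeSign S k
      - cubeWeight (Fintype.card ι) #(S ∆ {k}) * cubeSign (S ∆ {k}) k)
      = (if S = ∅ then 1 else 0) - (if S = univ then 1 else 0) := by
  set n := Fintype.card ι
  set s := #S
  have hsn : s ≤ n := Finset.card_le_univ S
  have h1 : ∀ k, (cubeWeight n s * cubeSign S k
      - cubeWeight n #(S ∆ {k}) * cubeSign (S ∆ {k}) k)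
      = if k ∈ S then -(cubeWeight n s + cubeWeight n (s - 1))
        else cubeWeight n s + cubeWeight n (s + 1) := by
    intro k
    by_cases hk : k ∈ S
    · have e : S ∆ {k} = S.erase k := by
        ext j; simp only [Finset.mem_symmDiff, mem_singleton, mem_erase]; grind
      rw [if_pos hk, e, Finset.card_erase_of_mem hk]
      simp [cubeSign, hk, s]
      ring
    · have e : S ∆ {k} = insert k S := by
        ext j; simp only [Finset.mem_symmDiff, mem_singleton, mem_insert]; grind
      rw [if_neg hk, e, Finset.card_insert_of_notMem hk]
      simp [cubeSign, hk, s]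
  rw [Finset.sum_congr rfl fun k _ => h1 k, Finset.sum_ite, Finset.sum_const, Finset.sum_const]
  have e1 : #{x ∈ (univ : Finset ι) | x ∈ S} = s := by simp [s]
  have e2 : (#{x ∈ (univ : Finset ι) | x ∉ S} : ℝ) = n - s := by
    have : #{x ∈ (univ : Finset ι) | x ∉ S} = n - s := by
      rw [← Finset.card_compl]; congr 1; ext; simp
    rw [this]; push_cast [hsn]; ring
  rw [e1, nsmul_eq_mul, nsmul_eq_mul, e2]
  -- The truncated subtraction at `s = 0` is harmless because of the factor `s`.
  have lo : (s : ℝ) * -(cubeWeight n s + cubeWeight n (s - 1))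
      = if s = 0 then 0 else -(n.choose s : ℝ)⁻¹ := by
    split_ifs with h0
    · simp [h0]
    · obtain ⟨m, hm⟩ := Nat.exists_eq_succ_of_ne_zero h0
      have hmn : m < n := by omega
      have h := sub_mul_cubeWeight_add hmn
      have hc : (0 : ℝ) < n.choose m := by exact_mod_cast Nat.choose_pos hmn.le
      have hc' : (0 : ℝ) < n.choose (m + 1) := by exact_mod_cast Nat.choose_pos hmn
      have h2 : (n.choose (m + 1) : ℝ) * (m + 1) = n.choose m * (n - m) := by
        have := Nat.choose_succ_right_eq n m
        have h2 : ((n - m : ℕ) : ℝ) = (n : ℝ) - m := by push_cast [hmn.le]; ring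
        rw [← h2]; exact_mod_cast this
      have hnm : (0 : ℝ) < (n : ℝ) - m := by
        have : (m : ℝ) < n := by exact_mod_cast hmn
        linarith
      rw [hm, Nat.succ_eq_add_one, Nat.add_sub_cancel]
      push_cast
      have h4 : cubeWeight n m + cubeWeight n (m + 1) = ((n - m) * (n.choose m : ℝ))⁻¹ := by
        rw [mul_inv, ← h]; field_simp
      rw [add_comm (cubeWeight n (m + 1)), h4, mul_comm ((n : ℝ) - m), ← h2]
      field_simp
  have hi : ((n : ℝ) - s) * (cubeWeight n s + cubeWeight n (s + 1))
      = if s = n then 0 else (n.choose s : ℝ)⁻¹ := by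
    split_ifs with h0
    · simp [h0]
    · exact sub_mul_cubeWeight_add (lt_of_le_of_ne hsn h0)
  rw [lo, hi]
  have hE : S = ∅ ↔ s = 0 := by simp [s]
  have hU : S = univ ↔ s = n := by simp [s, n, Finset.card_eq_iff_eq_univ]
  simp only [hE, hU]
  rcases eq_or_ne s 0 with a | a <;> rcases eq_or_ne s n with b | b
  · rw [if_pos a, if_pos b, if_pos a, if_pos b]; norm_num
  · rw [if_pos a, if_neg b, if_pos a, if_neg b, a]; simp
  · rw [if_neg a, if_pos b, if_neg a, if_pos b, b]; simp
  · rw [if_neg a, if_neg b, if_neg a, if_neg b]; simp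

/-- Summation by parts against the unit flow. The weight of `S` does not depend on the direction `k`
and the weights sum to `1`, so for fixed `S` the sum over `k` can later be recognized as an
Efron–Stein sum. -/
lemma cube_telescope (h : Finset ι → ℝ) :
    h ∅ - h univ = ∑ S : Finset ι, ∑ k,
      cubeWeight (Fintype.card ι) #S * (cubeSign S k * (h S - h (S ∆ {k}))) := by
  set c : Finset ι → ι → ℝ := fun S k => cubeWeight (Fintype.card ι) #S * cubeSign S k
  have hinv : ∀ k, Function.Involutive fun S : Finset ι => S ∆ {k} := fun k S => by
    simp
  have h2 : ∑ S : Finset ι, ∑ k, c S k * h (S ∆ {k})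
      = ∑ S : Finset ι, ∑ k, c (S ∆ {k}) k * h S := by
    rw [Finset.sum_comm, Finset.sum_comm (s := univ) (t := univ)
      (f := fun (S : Finset ι) k => c (S ∆ {k}) k * h S)]
    refine Finset.sum_congr rfl fun k _ => ?_
    rw [← Equiv.sum_comp (hinv k).toPerm]
    refine Finset.sum_congr rfl fun S _ => ?_
    simp
  have h3 : ∑ S : Finset ι, ∑ k,
      cubeWeight (Fintype.card ι) #S * (cubeSign S k * (h S - h (S ∆ {k})))
      = ∑ S : Finset ι, h S * ∑ k, (c S k - c (S ∆ {k}) k) := by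
    have : ∀ S : Finset ι, h S * ∑ k, (c S k - c (S ∆ {k}) k)
        = ∑ k, c S k * h S - ∑ k, c (S ∆ {k}) k * h S := by
      intro S
      rw [Finset.mul_sum, ← Finset.sum_sub_distrib]
      exact Finset.sum_congr rfl fun k _ => by ring
    rw [Finset.sum_congr rfl fun S _ => this S, Finset.sum_sub_distrib, ← h2,
      ← Finset.sum_sub_distrib]
    refine Finset.sum_congr rfl fun S _ => ?_
    rw [← Finset.sum_sub_distrib]
    exact Finset.sum_congr rfl fun k _ => by simp only [c]; ring
  rw [h3, Finset.sum_congr rfl fun S _ => by rw [show ∑ k, (c S k - c (S ∆ {k}) k) = _ from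
    cube_divergence S]]
  simp [mul_sub, Finset.sum_sub_distrib]

end Cube

/-! ### Bounded measurable functions -/

section BddMeas

variable {α β : Type*} [MeasurableSpace α] [MeasurableSpace β]

/-- Bounded measurable real functions. -/
def BddMeas (f : α → ℝ) : Prop := Measurable f ∧ ∃ C, ∀ x, |f x| ≤ C

namespace BddMeas

variable {f g : α → ℝ}

lemma integrable (hf : BddMeas f) (μ : Measure α) [IsFiniteMeasure μ] : Integrable f μ := by
  obtain ⟨hm, C, hC⟩ := hf
  exact Integrable.of_bound hm.aestronglyMeasurable C (ae_of_all _ hC)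

lemma const (c : ℝ) : BddMeas fun _ : α => c := ⟨measurable_const, |c|, fun _ => le_rfl⟩

lemma add (hf : BddMeas f) (hg : BddMeas g) : BddMeas fun x => f x + g x := by
  obtain ⟨hm, C, hC⟩ := hf
  obtain ⟨hm', D, hD⟩ := hg
  exact ⟨hm.add hm', C + D, fun x => (abs_add_le _ _).trans (add_le_add (hC x) (hD x))⟩

lemma neg (hf : BddMeas f) : BddMeas fun x => - f x := by
  obtain ⟨hm, C, hC⟩ := hf
  exact ⟨hm.neg, C, fun x => by rw [abs_neg]; exact hC x⟩

lemma sub (hf : BddMeas f) (hg : BddMeas g) : BddMeas fun x => f x - g x := by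
  simpa only [sub_eq_add_neg] using hf.add hg.neg

lemma mul (hf : BddMeas f) (hg : BddMeas g) : BddMeas fun x => f x * g x := by
  obtain ⟨hm, C, hC⟩ := hf
  obtain ⟨hm', D, hD⟩ := hg
  refine ⟨hm.mul hm', C * D, fun x => ?_⟩
  rw [abs_mul]
  exact mul_le_mul (hC x) (hD x) (abs_nonneg _) ((abs_nonneg _).trans (hC x))

lemma pow (hf : BddMeas f) (n : ℕ) : BddMeas fun x => f x ^ n := by
  induction n with
  | zero => simpa using const (α := α) 1
  | succ n ih => simpa only [pow_succ] using ih.mul hf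

lemma abs (hf : BddMeas f) : BddMeas fun x => |f x| := by
  obtain ⟨hm, C, hC⟩ := hf
  exact ⟨hm.abs, C, fun x => by rw [abs_abs]; exact hC x⟩

lemma max (hf : BddMeas f) (hg : BddMeas g) : BddMeas fun x => max (f x) (g x) := by
  obtain ⟨hm, C, hC⟩ := hf
  obtain ⟨hm', D, hD⟩ := hg
  exact ⟨hm.max hm', Max.max C D, fun x => abs_max_le_max_abs_abs.trans (max_le_max (hC x) (hD x))⟩

lemma sum {κ : Type*} (s : Finset κ) {F : κ → α → ℝ} (hF : ∀ k ∈ s, BddMeas (F k)) :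
    BddMeas fun x => ∑ k ∈ s, F k x := by
  classical
  induction s using Finset.induction_on with
  | empty => simpa using const (α := α) 0
  | insert a s ha ih =>
    simp only [Finset.sum_insert ha]
    exact (hF a (by simp)).add (ih fun k hk => hF k (by simp [hk]))

lemma comp (hf : BddMeas f) {φ : β → α} (hφ : Measurable φ) : BddMeas fun x => f (φ x) := by
  obtain ⟨hm, C, hC⟩ := hf
  exact ⟨hm.comp hφ, C, fun x => hC _⟩

lemma iSup {κ : Type*} [Countable κ] {F : κ → α → ℝ} (hF : ∀ k, Measurable (F k))
    {C : ℝ} (hC : ∀ k x, |F k x| ≤ C) : BddMeas fun x => ⨆ k, F k x := by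
  -- For an empty index type the supremum is `0` and `C` may be negative, hence `|C|`.
  refine ⟨Measurable.iSup hF, |C|, fun x => ?_⟩
  rcases isEmpty_or_nonempty κ with h | ⟨⟨k⟩⟩
  · simp
  · have hb : BddAbove (Set.range fun k => F k x) :=
      ⟨C, by rintro _ ⟨k, rfl⟩; exact (abs_le.mp (hC k x)).2⟩
    have : Nonempty κ := ⟨k⟩
    refine (abs_le.mpr ⟨?_, ciSup_le fun k => (abs_le.mp (hC k x)).2⟩).trans (le_abs_self C)
    exact (abs_le.mp (hC k x)).1.trans (le_ciSup hb k)

end BddMeas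

lemma measurePreserving_integral_comp {μ : Measure α} {ν : Measure β} {φ : α → β}
    (h : MeasurePreserving φ μ ν) {f : β → ℝ} (hf : Measurable f) :
    ∫ x, f (φ x) ∂μ = ∫ y, f y ∂ν := by
  rw [← h.map_eq, integral_map h.measurable.aemeasurable hf.aestronglyMeasurable]

end BddMeas

/-! ### The covariance formula on a product space -/

section Swap

open Finset
open scoped symmDiff

variable {ι : Type*} [DecidableEq ι] {E : Type*}

/-- Exchange the two copies in the coordinates belonging to `S`. -/
def swapOn (S : Finset ι) (θ : ι → E × E) : ι → E × E :=
  fun k => if k ∈ S then (θ k).swap else θ k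

/-- The first of two copies. -/
def firstCopy (θ : ι → E × E) : ι → E := fun k => (θ k).1

lemma swapOn_swapOn (S T : Finset ι) (θ : ι → E × E) :
    swapOn S (swapOn T θ) = swapOn (S ∆ T) θ := by
  funext k
  by_cases h1 : k ∈ S <;> by_cases h2 : k ∈ T <;>
    simp [swapOn, h1, h2, Finset.mem_symmDiff]

lemma swapOn_empty (θ : ι → E × E) : swapOn ∅ θ = θ := by
  funext k; simp [swapOn]

lemma firstCopy_swapOn_singleton (k : ι) (θ : ι → E × E) :
    firstCopy (swapOn {k} θ) = Function.update (firstCopy θ) k (θ k).2 := by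
  funext j
  by_cases h : j = k
  · subst h; simp [firstCopy, swapOn]
  · simp [firstCopy, swapOn, h]

variable [MeasurableSpace E]

lemma measurable_swapOn (S : Finset ι) : Measurable (swapOn S : (ι → E × E) → _) := by
  refine measurable_pi_lambda _ fun k => ?_
  by_cases h : k ∈ S
  · simp only [swapOn, h, if_true]; exact measurable_swap.comp (measurable_pi_apply k)
  · simpa [swapOn, h] using measurable_pi_apply k

omit [DecidableEq ι] in
lemma measurable_firstCopy : Measurable (firstCopy : (ι → E × E) → _) :=
  measurable_pi_lambda _ fun k => measurable_fst.comp (measurable_pi_apply k)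

variable [Fintype ι] (μ : ι → Measure E) [∀ k, IsProbabilityMeasure (μ k)]

/-- Two independent copies of a vector of independent random elements. -/
noncomputable abbrev pairMeasure : Measure (ι → E × E) := Measure.pi fun k => (μ k).prod (μ k)

lemma measurePreserving_swapOn (S : Finset ι) :
    MeasurePreserving (swapOn S) (pairMeasure μ) (pairMeasure μ) := by
  have := measurePreserving_pi (fun k => (μ k).prod (μ k)) (fun k => (μ k).prod (μ k))
    (f := fun k p => if k ∈ S then p.swap else p) (fun k => by
      by_cases h : k ∈ S
      · simp only [h, if_true]; exact Measure.measurePreserving_swap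
      · simp only [h, if_false]; exact MeasurePreserving.id _)
  exact this

omit [DecidableEq ι] in
lemma measurePreserving_firstCopy :
    MeasurePreserving firstCopy (pairMeasure μ) (Measure.pi μ) :=
  measurePreserving_pi (fun k => (μ k).prod (μ k)) μ fun _ => measurePreserving_fst

variable {μ}

lemma integral_firstCopy_swapOn {f : (ι → E) → ℝ} (hf : Measurable f) (S : Finset ι) :
    ∫ θ, f (firstCopy (swapOn S θ)) ∂pairMeasure μ = ∫ x, f x ∂Measure.pi μ :=
  measurePreserving_integral_comp
    ((measurePreserving_firstCopy μ).comp (measurePreserving_swapOn μ S)) hf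

/-- Exchanging all coordinates produces the second copy, which is independent of the first. -/
lemma integral_mul_firstCopy {f g : (ι → E) → ℝ} (hf : Measurable f) (hg : Measurable g) :
    ∫ θ, f (firstCopy (swapOn univ θ)) * g (firstCopy θ) ∂pairMeasure μ
      = (∫ x, f x ∂Measure.pi μ) * ∫ x, g x ∂Measure.pi μ := by
  have h := measurePreserving_arrowProdEquivProdArrow E E ι μ μ
  have h2 := measurePreserving_integral_comp h
    (f := fun p => f p.2 * g p.1) ((hf.comp measurable_snd).mul (hg.comp measurable_fst))
  have h3 : ∀ θ : ι → E × E, firstCopy (swapOn univ θ)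
      = (MeasurableEquiv.arrowProdEquivProdArrow E E ι θ).2 := fun θ => by
    funext k; simp [firstCopy, swapOn, MeasurableEquiv.arrowProdEquivProdArrow]
  have h4 : ∀ θ : ι → E × E, firstCopy θ
      = (MeasurableEquiv.arrowProdEquivProdArrow E E ι θ).1 := fun θ => rfl
  simp only [h3, h4]
  rw [h2]
  simp only [mul_comm (f _)]
  rw [integral_prod_mul, mul_comm]

/-- A covariance formula in terms of discrete derivatives. -/
lemma integral_sub_mul_eq {f g : (ι → E) → ℝ} (hf : BddMeas f) (hg : BddMeas g) :
    ∫ x, (f x - ∫ y, f y ∂Measure.pi μ) * g x ∂Measure.pi μ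
      = ∑ S : Finset ι, ∑ k, cubeWeight (Fintype.card ι) #S * (cubeSign S k / 2 *
          ∫ θ, (f (firstCopy (swapOn S θ)) - f (firstCopy (swapOn (S ∆ {k}) θ)))
            * (g (firstCopy θ) - g (firstCopy (swapOn {k} θ))) ∂pairMeasure μ) := by
  have mS : ∀ S : Finset ι, Measurable fun θ : ι → E × E => firstCopy (swapOn S θ) :=
    fun S => measurable_firstCopy.comp (measurable_swapOn S)
  have bf : ∀ S : Finset ι, BddMeas fun θ : ι → E × E => f (firstCopy (swapOn S θ)) :=
    fun S => hf.comp (mS S)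
  have bg : ∀ S : Finset ι, BddMeas fun θ : ι → E × E => g (firstCopy (swapOn S θ)) :=
    fun S => hg.comp (mS S)
  have bg0 : BddMeas fun θ : ι → E × E => g (firstCopy θ) := hg.comp measurable_firstCopy
  -- Exchanging coordinate `k` preserves the measure and reverses the sign of the increment of `f`,
  -- so only the part of `g` that is antisymmetric under this exchange contributes.
  have key : ∀ (S : Finset ι) (k : ι),
      ∫ θ, (f (firstCopy (swapOn S θ)) - f (firstCopy (swapOn (S ∆ {k}) θ))) * g (firstCopy θ)
        ∂pairMeasure μ
      = 1 / 2 * ∫ θ, (f (firstCopy (swapOn S θ)) - f (firstCopy (swapOn (S ∆ {k}) θ)))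
            * (g (firstCopy θ) - g (firstCopy (swapOn {k} θ))) ∂pairMeasure μ := by
    intro S k
    have e : ∫ θ, (f (firstCopy (swapOn S θ)) - f (firstCopy (swapOn (S ∆ {k}) θ)))
          * g (firstCopy (swapOn {k} θ)) ∂pairMeasure μ
        = - ∫ θ, (f (firstCopy (swapOn S θ)) - f (firstCopy (swapOn (S ∆ {k}) θ)))
          * g (firstCopy θ) ∂pairMeasure μ := by
      rw [← measurePreserving_integral_comp (measurePreserving_swapOn μ {k})
        ((((bf S).sub (bf _)).mul (bg {k})).1), ← integral_neg]
      refine integral_congr_ae (ae_of_all _ fun θ => ?_)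
      simp only [swapOn_swapOn, symmDiff_assoc, symmDiff_self, symmDiff_bot]
      rw [Finset.bot_eq_empty, swapOn_empty]
      ring
    have e2 : ∫ θ, (f (firstCopy (swapOn S θ)) - f (firstCopy (swapOn (S ∆ {k}) θ)))
            * (g (firstCopy θ) - g (firstCopy (swapOn {k} θ))) ∂pairMeasure μ
        = ∫ θ, (f (firstCopy (swapOn S θ)) - f (firstCopy (swapOn (S ∆ {k}) θ)))
          * g (firstCopy θ) ∂pairMeasure μ
        - ∫ θ, (f (firstCopy (swapOn S θ)) - f (firstCopy (swapOn (S ∆ {k}) θ)))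
          * g (firstCopy (swapOn {k} θ)) ∂pairMeasure μ := by
      rw [← integral_sub ((((bf S).sub (bf _)).mul bg0).integrable _)
        ((((bf S).sub (bf _)).mul (bg {k})).integrable _)]
      refine integral_congr_ae (ae_of_all _ fun θ => ?_)
      ring
    rw [e2, e]; ring
  set m := ∫ y, f y ∂Measure.pi μ
  -- The mean of `f` is replaced by `f` at the independent copy; the difference of `f` between the
  -- two ends of the cube can then be telescoped.
  have h1 : ∫ x, (f x - m) * g x ∂Measure.pi μ
      = ∫ θ, (f (firstCopy (swapOn ∅ θ)) - f (firstCopy (swapOn univ θ))) * g (firstCopy θ)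
        ∂pairMeasure μ := by
    have a1 : ∫ x, (f x - m) * g x ∂Measure.pi μ
        = ∫ x, f x * g x ∂Measure.pi μ - m * ∫ x, g x ∂Measure.pi μ := by
      rw [← integral_const_mul, ← integral_sub ((hf.mul hg).integrable _)
        ((hg.integrable _).const_mul m)]
      refine integral_congr_ae (ae_of_all _ fun θ => ?_)
      ring
    have a2 : ∫ θ, (f (firstCopy (swapOn ∅ θ)) - f (firstCopy (swapOn univ θ)))
          * g (firstCopy θ) ∂pairMeasure μ
        = ∫ θ, f (firstCopy (swapOn ∅ θ)) * g (firstCopy θ) ∂pairMeasure μ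
          - ∫ θ, f (firstCopy (swapOn univ θ)) * g (firstCopy θ) ∂pairMeasure μ := by
      rw [← integral_sub (((bf _).mul bg0).integrable _) (((bf _).mul bg0).integrable _)]
      refine integral_congr_ae (ae_of_all _ fun θ => ?_)
      ring
    rw [a1, a2, integral_mul_firstCopy hf.1 hg.1]
    simp only [swapOn_empty]
    rw [measurePreserving_integral_comp (measurePreserving_firstCopy μ)
      (f := fun x => f x * g x) (hf.mul hg).1]
  rw [h1]
  have h2 : ∀ θ : ι → E × E,
      (f (firstCopy (swapOn ∅ θ)) - f (firstCopy (swapOn univ θ))) * g (firstCopy θ)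
      = ∑ S : Finset ι, ∑ k, (cubeWeight (Fintype.card ι) #S * cubeSign S k) *
        ((f (firstCopy (swapOn S θ)) - f (firstCopy (swapOn (S ∆ {k}) θ))) * g (firstCopy θ)) := by
    intro θ
    rw [cube_telescope fun S => f (firstCopy (swapOn S θ)), Finset.sum_mul]
    refine Finset.sum_congr rfl fun S _ => ?_
    rw [Finset.sum_mul]
    exact Finset.sum_congr rfl fun k _ => by ring
  simp only [h2]
  have hi : ∀ (S : Finset ι) (k : ι), Integrable (fun θ =>
      (cubeWeight (Fintype.card ι) #S * cubeSign S k) *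
        ((f (firstCopy (swapOn S θ)) - f (firstCopy (swapOn (S ∆ {k}) θ))) * g (firstCopy θ)))
      (pairMeasure μ) := fun S k =>
    ((((bf S).sub (bf _)).mul bg0).integrable _).const_mul _
  rw [integral_finsetSum _ fun S _ => integrable_finsetSum _ fun k _ => hi S k]
  refine Finset.sum_congr rfl fun S _ => ?_
  rw [integral_finsetSum _ fun k _ => hi S k]
  refine Finset.sum_congr rfl fun k _ => ?_
  rw [integral_const_mul, key]
  ring

end Swap

/-! ### Moment inequalities -/

section Moments

open Finset
open scoped symmDiff

/-- Young's inequality with exponents `(n + 1) / n` and `n + 1`; the induction rests on `a ^ (n + 1)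
- b ^ (n + 1)` and `a - b` having the same sign. -/
lemma succ_mul_pow_mul_le {a b : ℝ} (ha : 0 ≤ a) (hb : 0 ≤ b) (n : ℕ) :
    (n + 1) * (a ^ n * b) ≤ n * a ^ (n + 1) + b ^ (n + 1) := by
  induction n with
  | zero => simp
  | succ n ih =>
    have h1 : 0 ≤ (a ^ (n + 1) - b ^ (n + 1)) * (a - b) := by
      rcases le_total a b with h | h
      · exact mul_nonneg_of_nonpos_of_nonpos (sub_nonpos.2 (pow_le_pow_left₀ ha h _))
          (sub_nonpos.2 h)
      · exact mul_nonneg (sub_nonneg.2 (pow_le_pow_left₀ hb h _)) (sub_nonneg.2 h)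
    have h2 := mul_le_mul_of_nonneg_right ih ha
    push_cast
    simp only [pow_succ] at *
    nlinarith [h1, h2]

variable {ι : Type*} [Fintype ι] [DecidableEq ι] {E : Type*} [MeasurableSpace E]
  {μ : ι → Measure E} [∀ k, IsProbabilityMeasure (μ k)]

/-- The Efron–Stein sum of squared increments under resampling one coordinate. -/
def efronStein (f : (ι → E) → ℝ) (θ : ι → E × E) : ℝ :=
  ∑ k, (f (firstCopy θ) - f (firstCopy (swapOn {k} θ))) ^ 2

omit [MeasurableSpace E] in
lemma efronStein_nonneg (f : (ι → E) → ℝ) (θ : ι → E × E) : 0 ≤ efronStein f θ :=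
  Finset.sum_nonneg fun _ _ => sq_nonneg _

omit [Fintype ι] in
lemma BddMeas.firstCopy_swapOn {f : (ι → E) → ℝ} (hf : BddMeas f) (S : Finset ι) :
    BddMeas fun θ : ι → E × E => f (firstCopy (swapOn S θ)) :=
  hf.comp (measurable_firstCopy.comp (measurable_swapOn S))

lemma BddMeas.efronStein {f : (ι → E) → ℝ} (hf : BddMeas f) : BddMeas (efronStein f) :=
  BddMeas.sum _ fun k _ =>
    ((hf.comp measurable_firstCopy).sub (hf.firstCopy_swapOn {k})).pow 2

/-- One term of the covariance formula with `g = (f - m) ^ (2n + 1)`. The mean value bound turns the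
increment of the power into an increment of `f`, AM–GM separates the two increments of `f`, and
exchanging coordinate `k` identifies the two resulting integrals. -/
lemma integral_mul_le_of_swap {f : (ι → E) → ℝ} (hf : BddMeas f) (m : ℝ) (n : ℕ)
    (S : Finset ι) (k : ι) :
    cubeSign S k / 2 *
      ∫ θ, (f (firstCopy (swapOn S θ)) - f (firstCopy (swapOn (S ∆ {k}) θ)))
        * ((f (firstCopy θ) - m) ^ (2 * n + 1)
          - (f (firstCopy (swapOn {k} θ)) - m) ^ (2 * n + 1)) ∂pairMeasure μ
    ≤ (2 * n + 1) / 2 * ∫ θ, ((f (firstCopy (swapOn S θ)) - f (firstCopy (swapOn (S ∆ {k}) θ))) ^ 2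
        + (f (firstCopy θ) - f (firstCopy (swapOn {k} θ))) ^ 2)
          * (f (firstCopy θ) - m) ^ (2 * n) ∂pairMeasure μ := by
  set D : (ι → E × E) → ℝ :=
    fun θ => f (firstCopy (swapOn S θ)) - f (firstCopy (swapOn (S ∆ {k}) θ))
  set D' : (ι → E × E) → ℝ := fun θ => f (firstCopy θ) - f (firstCopy (swapOn {k} θ))
  set F : (ι → E × E) → ℝ := fun θ => f (firstCopy θ) - m
  set F' : (ι → E × E) → ℝ := fun θ => f (firstCopy (swapOn {k} θ)) - m
  have bF : BddMeas F := (hf.comp measurable_firstCopy).sub (BddMeas.const m)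
  have bF' : BddMeas F' := (hf.firstCopy_swapOn _).sub (BddMeas.const m)
  have bD : BddMeas D := (hf.firstCopy_swapOn _).sub (hf.firstCopy_swapOn _)
  have bD' : BddMeas D' := (hf.comp measurable_firstCopy).sub (hf.firstCopy_swapOn _)
  have hpt : ∀ θ, cubeSign S k / 2 * (D θ * (F θ ^ (2 * n + 1) - F' θ ^ (2 * n + 1)))
      ≤ (2 * n + 1) / 4 * ((D θ ^ 2 + D' θ ^ 2) * F θ ^ (2 * n)
        + (D θ ^ 2 + D' θ ^ 2) * F' θ ^ (2 * n)) := by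
    intro θ
    have h1 : |F θ ^ (2 * n + 1) - F' θ ^ (2 * n + 1)|
        ≤ |D' θ| * (2 * n + 1) * (F θ ^ (2 * n) + F' θ ^ (2 * n)) := by
      refine (abs_pow_sub_pow_le (F θ) (F' θ) (2 * n + 1)).trans ?_
      have : F θ - F' θ = D' θ := by simp only [F, F', D']; ring
      rw [this]
      push_cast
      refine mul_le_mul_of_nonneg_left ?_ (by positivity)
      have e1 : ∀ y : ℝ, |y| ^ (2 * n) = y ^ (2 * n) := fun y => (even_two_mul n).pow_abs y
      have p1 : 0 ≤ F θ ^ (2 * n) := (even_two_mul n).pow_nonneg _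
      have p2 : 0 ≤ F' θ ^ (2 * n) := (even_two_mul n).pow_nonneg _
      rcases max_choice |F θ| |F' θ| with h | h <;> rw [h, e1] <;> linarith
    have p1 : 0 ≤ F θ ^ (2 * n) := (even_two_mul n).pow_nonneg _
    have p2 : 0 ≤ F' θ ^ (2 * n) := (even_two_mul n).pow_nonneg _
    have h2 : cubeSign S k / 2 * (D θ * (F θ ^ (2 * n + 1) - F' θ ^ (2 * n + 1)))
        ≤ 1 / 2 * (|D θ| * (|D' θ| * (2 * n + 1) * (F θ ^ (2 * n) + F' θ ^ (2 * n)))) := by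
      refine (le_abs_self _).trans ?_
      rw [abs_mul, abs_mul, abs_div, abs_cubeSign, abs_two]
      gcongr
    refine h2.trans ?_
    have h3 : |D θ| * |D' θ| ≤ (D θ ^ 2 + D' θ ^ 2) / 2 := by
      rw [← sq_abs (D θ), ← sq_abs (D' θ)]
      nlinarith [sq_nonneg (|D θ| - |D' θ|)]
    calc _ = (|D θ| * |D' θ|) * ((2 * n + 1) / 2 * (F θ ^ (2 * n) + F' θ ^ (2 * n))) := by ring
      _ ≤ (D θ ^ 2 + D' θ ^ 2) / 2 * ((2 * n + 1) / 2 * (F θ ^ (2 * n) + F' θ ^ (2 * n))) :=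
        mul_le_mul_of_nonneg_right h3 (by positivity)
      _ = _ := by ring
  have b1 : BddMeas fun θ => (D θ ^ 2 + D' θ ^ 2) * F θ ^ (2 * n) :=
    ((bD.pow 2).add (bD'.pow 2)).mul (bF.pow _)
  have b2 : BddMeas fun θ => (D θ ^ 2 + D' θ ^ 2) * F' θ ^ (2 * n) :=
    ((bD.pow 2).add (bD'.pow 2)).mul (bF'.pow _)
  have hsw : ∫ θ, (D θ ^ 2 + D' θ ^ 2) * F' θ ^ (2 * n) ∂pairMeasure μ
      = ∫ θ, (D θ ^ 2 + D' θ ^ 2) * F θ ^ (2 * n) ∂pairMeasure μ := by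
    rw [← measurePreserving_integral_comp (measurePreserving_swapOn μ {k}) b2.1]
    refine integral_congr_ae (ae_of_all _ fun θ => ?_)
    simp only [D, D', F, F', swapOn_swapOn, symmDiff_assoc, symmDiff_self, symmDiff_bot]
    rw [Finset.bot_eq_empty, swapOn_empty]
    ring
  rw [← integral_const_mul]
  refine (integral_mono (((bD.mul ((bF.pow _).sub (bF'.pow _))).integrable _).const_mul _)
    (((b1.integrable _).add (b2.integrable _)).const_mul _) hpt).trans ?_
  simp only [Pi.add_apply]
  rw [integral_const_mul, integral_add (b1.integrable _) (b2.integrable _), hsw]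
  apply le_of_eq
  ring

/-- The Efron–Stein inequality for even moments. -/
theorem integral_pow_le_efronStein {f : (ι → E) → ℝ} (hf : BddMeas f) (n : ℕ) :
    ∫ x, (f x - ∫ y, f y ∂Measure.pi μ) ^ (2 * (n + 1)) ∂Measure.pi μ
      ≤ (2 * n + 1 : ℝ) ^ (n + 1) * ∫ θ, efronStein f θ ^ (n + 1) ∂pairMeasure μ := by
  set m := ∫ y, f y ∂Measure.pi μ
  set I := ∫ x, (f x - m) ^ (2 * (n + 1)) ∂Measure.pi μ
  set J := ∫ θ, efronStein f θ ^ (n + 1) ∂pairMeasure μ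
  have bF : BddMeas fun x => f x - m := hf.sub (BddMeas.const m)
  have bFθ : BddMeas fun θ : ι → E × E => f (firstCopy θ) - m := bF.comp measurable_firstCopy
  have bV : BddMeas (efronStein f) := hf.efronStein
  have bVS : ∀ S : Finset ι, BddMeas fun θ => efronStein f (swapOn S θ) :=
    fun S => bV.comp (measurable_swapOn S)
  have hI : I = ∫ x, (f x - m) * (f x - m) ^ (2 * n + 1) ∂Measure.pi μ := by
    refine integral_congr_ae (ae_of_all _ fun x => ?_)
    simp only; ring
  have hIθ : ∫ θ, (f (firstCopy θ) - m) ^ (2 * (n + 1)) ∂pairMeasure μ = I :=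
    measurePreserving_integral_comp (measurePreserving_firstCopy μ)
      (f := fun x => (f x - m) ^ (2 * (n + 1))) (bF.pow _).1
  have hJS : ∀ S : Finset ι, ∫ θ, efronStein f (swapOn S θ) ^ (n + 1) ∂pairMeasure μ = J :=
    fun S => measurePreserving_integral_comp (measurePreserving_swapOn μ S)
      (f := fun θ => efronStein f θ ^ (n + 1)) (bV.pow _).1
  have hVS : ∀ (S : Finset ι) (θ : ι → E × E), ∑ k,
      (f (firstCopy (swapOn S θ)) - f (firstCopy (swapOn (S ∆ {k}) θ))) ^ 2
      = efronStein f (swapOn S θ) := by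
    intro S θ
    simp only [efronStein, swapOn_swapOn, symmDiff_comm]
  -- Young's inequality with `a = (f - m)²` and `b = (2n + 1) V`. The point `swapOn S θ` has the
  -- same law as `θ`, so the bound does not depend on `S`.
  have young : ∀ S : Finset ι, (2 * n + 1) * ∫ θ, efronStein f (swapOn S θ)
      * (f (firstCopy θ) - m) ^ (2 * n) ∂pairMeasure μ
      ≤ (n * I + (2 * n + 1 : ℝ) ^ (n + 1) * J) / (n + 1) := by
    intro S
    rw [← integral_const_mul]
    have hpt : ∀ θ, (2 * n + 1) * (efronStein f (swapOn S θ) * (f (firstCopy θ) - m) ^ (2 * n))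
        ≤ n / (n + 1) * (f (firstCopy θ) - m) ^ (2 * (n + 1))
          + (2 * n + 1 : ℝ) ^ (n + 1) / (n + 1) * efronStein f (swapOn S θ) ^ (n + 1) := by
      intro θ
      have := succ_mul_pow_mul_le (sq_nonneg (f (firstCopy θ) - m))
        (mul_nonneg (by positivity : (0 : ℝ) ≤ 2 * n + 1) (efronStein_nonneg f (swapOn S θ))) n
      rw [← pow_mul, ← pow_mul, mul_pow] at this
      rw [div_mul_eq_mul_div, div_mul_eq_mul_div, ← add_div, le_div_iff₀ (by positivity)]
      calc _ = _ := by ring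
        _ ≤ _ := this
    refine (integral_mono ((((bVS S).mul (bFθ.pow _)).integrable _).const_mul _)
      ((((bFθ.pow _).integrable _).const_mul _).add ((((bVS S).pow _).integrable _).const_mul _))
      hpt).trans (le_of_eq ?_)
    simp only [Pi.add_apply]
    rw [integral_add (((bFθ.pow _).integrable _).const_mul _)
      ((((bVS S).pow _).integrable _).const_mul _), integral_const_mul, integral_const_mul,
      hIθ, hJS]
    ring
  have main : I ≤ (n * I + (2 * n + 1 : ℝ) ^ (n + 1) * J) / (n + 1) := by
    calc I = _ := hI
      _ = _ := integral_sub_mul_eq hf (bF.pow (2 * n + 1))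
      _ ≤ ∑ S : Finset ι, ∑ k, cubeWeight (Fintype.card ι) #S *
          ((2 * n + 1) / 2 * ∫ θ, ((f (firstCopy (swapOn S θ))
            - f (firstCopy (swapOn (S ∆ {k}) θ))) ^ 2
          + (f (firstCopy θ) - f (firstCopy (swapOn {k} θ))) ^ 2)
          * (f (firstCopy θ) - m) ^ (2 * n) ∂pairMeasure μ) := by
        refine Finset.sum_le_sum fun S _ => Finset.sum_le_sum fun k _ => ?_
        exact mul_le_mul_of_nonneg_left (integral_mul_le_of_swap hf m n S k) (cubeWeight_nonneg _ _)
      _ = ∑ S : Finset ι, cubeWeight (Fintype.card ι) #S *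
          (((2 * n + 1) * ∫ θ, efronStein f (swapOn S θ)
            * (f (firstCopy θ) - m) ^ (2 * n) ∂pairMeasure μ
          + (2 * n + 1) * ∫ θ, efronStein f (swapOn ∅ θ)
            * (f (firstCopy θ) - m) ^ (2 * n) ∂pairMeasure μ) / 2) := by
        refine Finset.sum_congr rfl fun S _ => ?_
        rw [← Finset.mul_sum, ← Finset.mul_sum, ← integral_finsetSum]
        · rw [← mul_add, ← integral_add (((bVS S).mul (bFθ.pow _)).integrable _)
            (((bVS ∅).mul (bFθ.pow _)).integrable _)]
          rw [mul_div_right_comm]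
          congr 2
          refine integral_congr_ae (ae_of_all _ fun θ => ?_)
          simp only
          rw [← Finset.sum_mul, Finset.sum_add_distrib, hVS, swapOn_empty]
          rw [← add_mul]; rfl
        · intro k _
          exact BddMeas.integrable ((((hf.firstCopy_swapOn _).sub (hf.firstCopy_swapOn _)).pow 2
            |>.add (((hf.comp measurable_firstCopy).sub (hf.firstCopy_swapOn _)).pow 2)).mul
            (bFθ.pow _)) _
      _ ≤ ∑ S : Finset ι, cubeWeight (Fintype.card ι) #S *
          ((n * I + (2 * n + 1 : ℝ) ^ (n + 1) * J) / (n + 1)) := by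
        refine Finset.sum_le_sum fun S _ => mul_le_mul_of_nonneg_left ?_ (cubeWeight_nonneg _ _)
        have := young S
        have := young ∅
        linarith
      _ = _ := by rw [← Finset.sum_mul, sum_cubeWeight, one_mul]
  -- The term `n * I` on the right is absorbed into `(n + 1) * I` on the left.
  rw [le_div_iff₀ (by positivity)] at main
  linarith

/-- Moments of self-bounding functions. -/
theorem integral_pow_le_of_selfBounding {W : (ι → E) → ℝ} (hW : BddMeas W) (hW0 : ∀ x, 0 ≤ W x)
    {ρ : ℝ} (hρ0 : 0 ≤ ρ) (hρ : ∀ x k e, |W x - W (Function.update x k e)| ≤ ρ)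
    (hsb : ∀ x y : ι → E, ∑ k, max (W x - W (Function.update x k (y k))) 0 ≤ W x) (q : ℕ) :
    ∫ x, W x ^ q ∂Measure.pi μ ≤ (∫ x, W x ∂Measure.pi μ + q * ρ) ^ q := by
  set m := ∫ x, W x ∂Measure.pi μ
  have hm0 : 0 ≤ m := integral_nonneg hW0
  have bθ : BddMeas fun θ : ι → E × E => W (firstCopy θ) := hW.comp measurable_firstCopy
  -- The covariance of `W` and `W ^ (p + 1)` is estimated by bounding each increment of `W` by `ρ`
  -- and using self-boundedness for the increments of the power.
  have step : ∀ p : ℕ, ∫ x, W x ^ (p + 2) ∂Measure.pi μ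
      ≤ (m + (p + 1) * ρ) * ∫ x, W x ^ (p + 1) ∂Measure.pi μ := by
    intro p
    have diff : ∀ (θ : ι → E × E) (k : ι), W (firstCopy θ) ^ (p + 1)
        - W (firstCopy (swapOn {k} θ)) ^ (p + 1)
        ≤ (p + 1) * W (firstCopy θ) ^ p * max (W (firstCopy θ) - W (firstCopy (swapOn {k} θ))) 0 := by
      intro θ k
      set a := W (firstCopy θ)
      set b := W (firstCopy (swapOn {k} θ))
      have ha : 0 ≤ a := hW0 _
      have hb : 0 ≤ b := hW0 _
      rcases le_total a b with h | h
      · have := pow_le_pow_left₀ ha h (p + 1)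
        have : 0 ≤ (p + 1) * a ^ p * max (a - b) 0 := by positivity
        linarith
      · have := (le_abs_self _).trans (abs_pow_sub_pow_le a b (p + 1))
        rw [abs_of_nonneg (sub_nonneg.2 h), abs_of_nonneg ha, abs_of_nonneg hb, max_eq_left h] at this
        rw [max_eq_left (sub_nonneg.2 h)]
        push_cast at this
        calc _ ≤ _ := this
          _ = _ := by ring_nf
    set P : ι → (ι → E × E) → ℝ := fun k θ =>
      max (W (firstCopy θ) ^ (p + 1) - W (firstCopy (swapOn {k} θ)) ^ (p + 1)) 0
    have bP : ∀ k, BddMeas (P k) := fun k =>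
      ((bθ.pow _).sub ((hW.firstCopy_swapOn _).pow _)).max (BddMeas.const 0)
    -- Self-boundedness only controls decreases of `W`; by symmetry under the exchange, positive and
    -- negative parts have equal integrals, so positive parts suffice.
    have habs : ∀ k, ∫ θ, |W (firstCopy θ) ^ (p + 1)
        - W (firstCopy (swapOn {k} θ)) ^ (p + 1)| ∂pairMeasure μ
        = 2 * ∫ θ, P k θ ∂pairMeasure μ := by
      intro k
      have e1 : ∫ θ, P k (swapOn {k} θ) ∂pairMeasure μ = ∫ θ, P k θ ∂pairMeasure μ :=
        measurePreserving_integral_comp (measurePreserving_swapOn μ {k}) (bP k).1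
      have bP' : BddMeas fun θ => P k (swapOn {k} θ) := (bP k).comp (measurable_swapOn {k})
      rw [two_mul]
      nth_rewrite 2 [← e1]
      rw [← integral_add ((bP k).integrable _) (bP'.integrable _)]
      refine integral_congr_ae (ae_of_all _ fun θ => ?_)
      simp only [P, swapOn_swapOn, symmDiff_self]
      rw [Finset.bot_eq_empty, swapOn_empty]
      rcases le_total (W (firstCopy θ) ^ (p + 1)) (W (firstCopy (swapOn {k} θ)) ^ (p + 1))
        with h | h
      · rw [abs_of_nonpos (by linarith), max_eq_right (by linarith), max_eq_left (by linarith)]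
        ring
      · rw [abs_of_nonneg (by linarith), max_eq_left (by linarith), max_eq_right (by linarith)]
        ring
    have hD : ∀ (S : Finset ι) (k : ι) (θ : ι → E × E),
        |W (firstCopy (swapOn S θ)) - W (firstCopy (swapOn (S ∆ {k}) θ))| ≤ ρ := by
      intro S k θ
      have : swapOn (S ∆ {k}) θ = swapOn {k} (swapOn S θ) := by rw [swapOn_swapOn, symmDiff_comm]
      rw [this, firstCopy_swapOn_singleton]
      exact hρ _ _ _
    have term : ∀ (S : Finset ι) (k : ι), cubeSign S k / 2 *
        ∫ θ, (W (firstCopy (swapOn S θ)) - W (firstCopy (swapOn (S ∆ {k}) θ)))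
          * (W (firstCopy θ) ^ (p + 1) - W (firstCopy (swapOn {k} θ)) ^ (p + 1)) ∂pairMeasure μ
        ≤ ρ * ∫ θ, P k θ ∂pairMeasure μ := by
      intro S k
      have hle : ∫ θ, |(W (firstCopy (swapOn S θ)) - W (firstCopy (swapOn (S ∆ {k}) θ)))
          * (W (firstCopy θ) ^ (p + 1) - W (firstCopy (swapOn {k} θ)) ^ (p + 1))| ∂pairMeasure μ
          ≤ ρ * (2 * ∫ θ, P k θ ∂pairMeasure μ) := by
        rw [← habs, ← integral_const_mul]
        refine integral_mono ?_ ?_ fun θ => ?_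
        · exact BddMeas.integrable (((hW.firstCopy_swapOn _).sub (hW.firstCopy_swapOn _)).mul
            ((bθ.pow _).sub ((hW.firstCopy_swapOn _).pow _))).abs _
        · exact (BddMeas.integrable ((bθ.pow _).sub ((hW.firstCopy_swapOn _).pow _)).abs _).const_mul _
        · simp only [abs_mul]
          exact mul_le_mul_of_nonneg_right (hD S k θ) (abs_nonneg _)
      refine (le_abs_self _).trans ?_
      rw [abs_mul, abs_div, abs_cubeSign, abs_two]
      have := (abs_integral_le_integral_abs (μ := pairMeasure μ)).trans hle
      linarith
    have hsum : ∑ k, ∫ θ, P k θ ∂pairMeasure μ ≤ (p + 1) * ∫ x, W x ^ (p + 1) ∂Measure.pi μ := by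
      rw [← integral_finsetSum _ fun k _ => (bP k).integrable _, ← integral_const_mul,
        ← measurePreserving_integral_comp (measurePreserving_firstCopy μ)
          (f := fun x => (p + 1) * W x ^ (p + 1)) ((hW.pow _).1.const_mul _)]
      refine integral_mono ((BddMeas.sum _ fun k _ => bP k).integrable _)
        (((bθ.pow _).integrable _).const_mul _) fun θ => ?_
      have h1 : ∀ k, P k θ ≤ (p + 1) * W (firstCopy θ) ^ p
          * max (W (firstCopy θ) - W (firstCopy (swapOn {k} θ))) 0 := fun k =>
        max_le (diff θ k) (mul_nonneg (mul_nonneg (by positivity) (pow_nonneg (hW0 _) _))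
          (le_max_right _ _))
      refine (Finset.sum_le_sum fun k _ => h1 k).trans ?_
      rw [← Finset.mul_sum]
      have h2 : ∑ k, max (W (firstCopy θ) - W (firstCopy (swapOn {k} θ))) 0 ≤ W (firstCopy θ) := by
        simp only [firstCopy_swapOn_singleton]
        exact hsb (firstCopy θ) fun k => (θ k).2
      refine (mul_le_mul_of_nonneg_left h2 (mul_nonneg (by positivity)
        (pow_nonneg (hW0 _) _))).trans (le_of_eq ?_)
      ring
    have hcov := integral_sub_mul_eq (μ := μ) hW (hW.pow (p + 1))
    have hle : ∫ x, (W x - m) * W x ^ (p + 1) ∂Measure.pi μ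
        ≤ ρ * ((p + 1) * ∫ x, W x ^ (p + 1) ∂Measure.pi μ) := by
      calc _ = _ := hcov
        _ ≤ ∑ S : Finset ι, ∑ k, cubeWeight (Fintype.card ι) #S
            * (ρ * ∫ θ, P k θ ∂pairMeasure μ) :=
          Finset.sum_le_sum fun S _ => Finset.sum_le_sum fun k _ =>
            mul_le_mul_of_nonneg_left (term S k) (cubeWeight_nonneg _ _)
        _ = ρ * ∑ k, ∫ θ, P k θ ∂pairMeasure μ := by
          simp only [← Finset.mul_sum]
          rw [← Finset.sum_mul, sum_cubeWeight, one_mul]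
        _ ≤ _ := mul_le_mul_of_nonneg_left hsum hρ0
    have e : ∫ x, (W x - m) * W x ^ (p + 1) ∂Measure.pi μ
        = ∫ x, W x ^ (p + 2) ∂Measure.pi μ - m * ∫ x, W x ^ (p + 1) ∂Measure.pi μ := by
      rw [← integral_const_mul, ← integral_sub ((hW.pow _).integrable _)
        (((hW.pow _).integrable _).const_mul _)]
      refine integral_congr_ae (ae_of_all _ fun x => ?_)
      simp only; ring
    rw [e] at hle
    linarith
  have all : ∀ p : ℕ, p ≤ q → ∫ x, W x ^ p ∂Measure.pi μ ≤ (m + q * ρ) ^ p := by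
    intro p
    induction p with
    | zero => intro _; simp
    | succ p ih =>
      intro hp
      -- `step` starts at the second power; the first moment is `m` itself.
      rcases p with _ | p
      · simp only [zero_add, pow_one]
        have : (0 : ℝ) ≤ q * ρ := by positivity
        exact le_add_of_nonneg_right this
      · refine (step p).trans ?_
        rw [pow_succ' _ (p + 1)]
        have h1 : ((p : ℝ) + 1) * ρ ≤ q * ρ := by
          refine mul_le_mul_of_nonneg_right ?_ hρ0
          exact_mod_cast (by omega : p + 1 ≤ q)
        exact mul_le_mul (by linarith) (ih (by omega))
          (integral_nonneg fun x => pow_nonneg (hW0 x) _) (by positivity)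
  exact all q le_rfl

end Moments

/-! ### Suprema of sums of independent nonnegative functions -/

section Supremum

open Finset

variable {ι : Type*} [Fintype ι] [DecidableEq ι] {E : Type*} [MeasurableSpace E]
  {μ : ι → Measure E} [∀ k, IsProbabilityMeasure (μ k)] {T : Type*} [Countable T] [Nonempty T]

omit [DecidableEq ι] [Nonempty T] in
lemma BddMeas.iSup_sum {w : T → ι → E → ℝ} (hw : ∀ t k, Measurable (w t k)) {C : ℝ}
    (hC : ∀ t k e, |w t k e| ≤ C) : BddMeas fun x : ι → E => ⨆ t, ∑ k, w t k (x k) := by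
  refine BddMeas.iSup (C := Fintype.card ι * C) (fun t => ?_) fun t x => ?_
  · exact Finset.measurable_fun_sum _ fun k _ => (hw t k).comp (measurable_pi_apply k)
  · refine (Finset.abs_sum_le_sum_abs _ _).trans ?_
    refine (Finset.sum_le_sum fun k _ => hC t k (x k)).trans ?_
    simp

/-- Moments of the supremum of a sum of independent nonnegative bounded functions. -/
theorem integral_iSup_sum_pow_le {w : T → ι → E → ℝ} (hw : ∀ t k, Measurable (w t k)) {ρ : ℝ}
    (hρ0 : 0 ≤ ρ) (hw0 : ∀ t k e, 0 ≤ w t k e) (hρ : ∀ t k e, w t k e ≤ ρ) (q : ℕ) :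
    ∫ x, (⨆ t, ∑ k, w t k (x k)) ^ q ∂Measure.pi μ
      ≤ (∫ x, (⨆ t, ∑ k, w t k (x k)) ∂Measure.pi μ + q * ρ) ^ q := by
  have habs : ∀ t k e, |w t k e| ≤ ρ := fun t k e => by rw [abs_of_nonneg (hw0 t k e)]; exact hρ t k e
  have hb : ∀ x : ι → E, BddAbove (Set.range fun t => ∑ k, w t k (x k)) := fun x =>
    ⟨∑ _k : ι, ρ, by rintro _ ⟨t, rfl⟩; exact Finset.sum_le_sum fun k _ => hρ t k _⟩
  set W : (ι → E) → ℝ := fun x => ⨆ t, ∑ k, w t k (x k)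
  have hle : ∀ t x, ∑ k, w t k (x k) ≤ W x := fun t x => le_ciSup (hb x) t
  -- Since the terms are nonnegative, changing coordinate `k` lowers the sum for a fixed `t` by at
  -- most its own `k`-th term. At a maximizer these losses add up to `W x`, which is
  -- self-boundedness.
  have hupd : ∀ t (x : ι → E) k e,
      ∑ j, w t j (x j) - w t k (x k) ≤ ∑ j, w t j (Function.update x k e j) := by
    intro t x k e
    rw [← Finset.add_sum_erase _ _ (mem_univ k),
      ← Finset.add_sum_erase _ (fun j => w t j (Function.update x k e j)) (mem_univ k)]
    have h1 : ∑ j ∈ univ.erase k, w t j (Function.update x k e j)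
        = ∑ j ∈ univ.erase k, w t j (x j) := Finset.sum_congr rfl fun j hj => by
      rw [Function.update_of_ne (Finset.ne_of_mem_erase hj)]
    have h2 := hw0 t k (Function.update x k e k)
    rw [h1]
    linarith
  have hone : ∀ (x : ι → E) k e, W x - W (Function.update x k e) ≤ ρ := by
    intro x k e
    rw [sub_le_iff_le_add]
    refine ciSup_le fun t => ?_
    have h1 := hupd t x k e
    have h2 := hle t (Function.update x k e)
    have h3 := hρ t k (x k)
    linarith
  refine integral_pow_le_of_selfBounding (BddMeas.iSup_sum hw habs) (fun x => ?_) hρ0 ?_ ?_ q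
  · obtain ⟨t⟩ := ‹Nonempty T›
    exact (Finset.sum_nonneg fun k _ => hw0 t k (x k)).trans (hle t x)
  · intro x k e
    refine abs_sub_le_iff.2 ⟨hone x k e, ?_⟩
    have := hone (Function.update x k e) k (x k)
    simpa using this
  · intro x y
    by_contra! hlt
    set L := ∑ k, max (W x - W (Function.update x k (y k))) 0
    set δ := L - W x
    have hδ : 0 < δ := sub_pos.2 hlt
    set n : ℝ := (Fintype.card ι : ℝ)
    have hn : 0 ≤ n := Nat.cast_nonneg _
    -- The supremum need not be attained. A gap below `δ / (n + 1)` is small enough, since it enters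
    -- once for each of the `n` coordinates.
    obtain ⟨t, ht⟩ := exists_lt_of_lt_ciSup
      (show W x - δ / (n + 1) < W x from sub_lt_self _ (by positivity))
    have h1 : L ≤ ∑ k, ((W x - ∑ j, w t j (x j)) + w t k (x k)) := by
      refine Finset.sum_le_sum fun k _ => max_le ?_ ?_
      · have h1 := hupd t x k (y k)
        have h2 := hle t (Function.update x k (y k))
        linarith
      · have h1 := hle t x
        have h2 := hw0 t k (x k)
        linarith
    rw [Finset.sum_add_distrib, Finset.sum_const, Finset.card_univ, nsmul_eq_mul] at h1
    have h2 : n * (W x - ∑ j, w t j (x j)) ≤ n * (δ / (n + 1)) :=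
      mul_le_mul_of_nonneg_left (by linarith) hn
    have h3 : n * (δ / (n + 1)) < δ := by
      rw [← mul_div_assoc, div_lt_iff₀ (by positivity)]; linarith
    have h4 := hle t x
    linarith

end Supremum

/-! ### Random signs -/

section Signs

open Finset

variable {ι : Type*} [DecidableEq ι]

lemma cubeSign_insert_of_ne {a k : ι} (h : k ≠ a) (S : Finset ι) :
    cubeSign (insert a S) k = cubeSign S k := by
  simp [cubeSign, h]

lemma cubeSign_compl [Fintype ι] (S : Finset ι) (k : ι) : cubeSign Sᶜ k = - cubeSign S k := by
  by_cases h : k ∈ S <;> simp [cubeSign, h]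

/-- The left side is a supremum of `h t + h s + φ t - φ s` over pairs. Replacing the difference by
`|ψ t - ψ s|` loses nothing on the right, where `t` and `s` may be exchanged to choose the sign. -/
lemma iSup_add_iSup_le_of_abs_sub_le {T : Type*} [Nonempty T] {h φ ψ : T → ℝ}
    (hb : BddAbove (Set.range fun t => h t + ψ t)) (hb' : BddAbove (Set.range fun t => h t - ψ t))
    (hφ : ∀ t s, |φ t - φ s| ≤ |ψ t - ψ s|) :
    (⨆ t, (h t + φ t)) + ⨆ t, (h t - φ t) ≤ (⨆ t, (h t + ψ t)) + ⨆ t, (h t - ψ t) := by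
  rw [← le_sub_iff_add_le]
  refine ciSup_le fun t => ?_
  rw [le_sub_comm]
  refine ciSup_le fun s => ?_
  have h1 := (le_abs_self _).trans (hφ t s)
  have p1 := le_ciSup hb t
  have p2 := le_ciSup hb' s
  have p3 := le_ciSup hb s
  have p4 := le_ciSup hb' t
  rcases abs_cases (ψ t - ψ s) with ⟨h2, _⟩ | ⟨h2, _⟩ <;> rw [h2] at h1 <;> linarith

lemma bddAbove_range_add_sum {T : Type*} {s : Finset ι} {h : T → ℝ} {ψ : ι → T → ℝ} {C : ℝ}
    (hh : ∃ D, ∀ t, |h t| ≤ D) (hψ : ∀ k t, |ψ k t| ≤ C) (S : Finset ι) :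
    BddAbove (Set.range fun t => h t + ∑ k ∈ s, cubeSign S k * ψ k t) := by
  obtain ⟨D, hD⟩ := hh
  refine ⟨D + ∑ _k ∈ s, C, ?_⟩
  rintro _ ⟨t, rfl⟩
  refine add_le_add ((le_abs_self _).trans (hD t)) (Finset.sum_le_sum fun k _ => ?_)
  refine (le_abs_self _).trans ?_
  rw [abs_mul, abs_cubeSign, one_mul]
  exact hψ k t

/-- The contraction principle for random signs. -/
lemma sum_iSup_le_of_abs_sub_le {T : Type*} [Nonempty T] (s : Finset ι) {φ ψ : ι → T → ℝ} {C : ℝ}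
    (hφC : ∀ k t, |φ k t| ≤ C) (hψC : ∀ k t, |ψ k t| ≤ C)
    (hφ : ∀ k t t', |φ k t - φ k t'| ≤ |ψ k t - ψ k t'|) (h : T → ℝ) (hh : ∃ D, ∀ t, |h t| ≤ D) :
    ∑ S ∈ s.powerset, (⨆ t, (h t + ∑ k ∈ s, cubeSign S k * φ k t))
      ≤ ∑ S ∈ s.powerset, ⨆ t, (h t + ∑ k ∈ s, cubeSign S k * ψ k t) := by
  induction s using Finset.induction_on generalizing h with
  | empty => simp
  | insert a s ha ih =>
    have expand : ∀ χ : ι → T → ℝ,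
        ∑ S ∈ (insert a s).powerset, (⨆ t, (h t + ∑ k ∈ insert a s, cubeSign S k * χ k t))
        = ∑ S ∈ s.powerset, ((⨆ t, ((h t + χ a t) + ∑ k ∈ s, cubeSign S k * χ k t))
          + ⨆ t, ((h t - χ a t) + ∑ k ∈ s, cubeSign S k * χ k t)) := by
      intro χ
      rw [Finset.sum_powerset_insert ha, ← Finset.sum_add_distrib]
      refine Finset.sum_congr rfl fun S hS => ?_
      have haS : a ∉ S := fun h => ha (Finset.mem_powerset.1 hS h)
      congr 1
      · refine iSup_congr fun t => ?_
        rw [Finset.sum_insert ha]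
        simp only [cubeSign, haS, if_false]
        ring
      · refine iSup_congr fun t => ?_
        rw [Finset.sum_insert ha, Finset.sum_congr rfl fun k hk => by
          rw [cubeSign_insert_of_ne (ne_of_mem_of_not_mem hk ha)]]
        simp [cubeSign]
        ring
    obtain ⟨D, hD⟩ := hh
    have hD' : ∀ χ : ι → T → ℝ, (∀ k t, |χ k t| ≤ C) → ∃ D', ∀ t, |h t + χ a t| ≤ D' := fun χ hχ =>
      ⟨D + C, fun t => (abs_add_le _ _).trans (add_le_add (hD t) (hχ a t))⟩
    have hD'' : ∀ χ : ι → T → ℝ, (∀ k t, |χ k t| ≤ C) → ∃ D', ∀ t, |h t - χ a t| ≤ D' := fun χ hχ =>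
      ⟨D + C, fun t => (abs_sub _ _).trans (add_le_add (hD t) (hχ a t))⟩
    -- The induction hypothesis contracts the signs in `s` with `h ± φ a` as offset; the remaining
    -- sign is then contracted for each fixed `S`.
    rw [expand, expand, Finset.sum_add_distrib]
    refine (add_le_add (ih _ (hD' φ hφC)) (ih _ (hD'' φ hφC))).trans ?_
    rw [← Finset.sum_add_distrib]
    refine Finset.sum_le_sum fun S _ => ?_
    have b1 := bddAbove_range_add_sum (s := s) (hD' ψ hψC) hψC S
    have b2 := bddAbove_range_add_sum (s := s) (hD'' ψ hψC) hψC S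
    have := iSup_add_iSup_le_of_abs_sub_le (h := fun t => h t + ∑ k ∈ s, cubeSign S k * ψ k t)
      (φ := φ a) (ψ := ψ a) (by simpa only [add_right_comm] using b1)
      (by simpa only [sub_add_eq_add_sub] using b2) (hφ a)
    simpa only [sub_add_eq_add_sub, add_right_comm] using this

/-- Orthogonality of random signs, obtained by applying the parallelogram law to one sign at a time.
-/
lemma sum_norm_add_signed_sum_sq {V : Type*} [NormedAddCommGroup V] [InnerProductSpace ℂ V]
    (s : Finset ι) (y : ι → V) (v : V) :
    ∑ S ∈ s.powerset, ‖v + ∑ k ∈ s, (cubeSign S k : ℝ) • y k‖ ^ 2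
      = 2 ^ #s * (‖v‖ ^ 2 + ∑ k ∈ s, ‖y k‖ ^ 2) := by
  induction s using Finset.induction_on generalizing v with
  | empty => simp
  | insert a s ha ih =>
    rw [Finset.sum_powerset_insert ha]
    have e1 : ∑ S ∈ s.powerset, ‖v + ∑ k ∈ insert a s, (cubeSign S k : ℝ) • y k‖ ^ 2
        = ∑ S ∈ s.powerset, ‖(v + y a) + ∑ k ∈ s, (cubeSign S k : ℝ) • y k‖ ^ 2 := by
      refine Finset.sum_congr rfl fun S hS => ?_
      have haS : a ∉ S := fun h => ha (Finset.mem_powerset.1 hS h)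
      rw [Finset.sum_insert ha]
      simp only [cubeSign, haS, if_false, one_smul, add_assoc]
    have e2 : ∑ S ∈ s.powerset, ‖v + ∑ k ∈ insert a s, (cubeSign (insert a S) k : ℝ) • y k‖ ^ 2
        = ∑ S ∈ s.powerset, ‖(v - y a) + ∑ k ∈ s, (cubeSign S k : ℝ) • y k‖ ^ 2 := by
      refine Finset.sum_congr rfl fun S hS => ?_
      rw [Finset.sum_insert ha, Finset.sum_congr rfl fun k hk => by
          rw [cubeSign_insert_of_ne (ne_of_mem_of_not_mem hk ha)]]
      simp [cubeSign, sub_eq_add_neg, add_assoc]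
    rw [e1, e2, ih, ih, Finset.card_insert_of_notMem ha, Finset.sum_insert ha]
    have := parallelogram_law_with_norm ℂ v (y a)
    rw [pow_succ]
    linear_combination 2 ^ #s * this

end Signs

/-! ### Symmetrization -/

section Symmetrization

open Finset

variable {ι : Type*} [Fintype ι] [DecidableEq ι] {E : Type*} [MeasurableSpace E]
  {μ : ι → Measure E} [∀ k, IsProbabilityMeasure (μ k)]

/-- The second of two copies. -/
def secondCopy (θ : ι → E × E) : ι → E := fun k => (θ k).2

omit [MeasurableSpace E] in
lemma firstCopy_swapOn_univ (θ : ι → E × E) : firstCopy (swapOn univ θ) = secondCopy θ := by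
  funext k; simp [firstCopy, secondCopy, swapOn]

lemma BddMeas.secondCopy {f : (ι → E) → ℝ} (hf : BddMeas f) :
    BddMeas fun θ : ι → E × E => f (secondCopy θ) := by
  simpa only [firstCopy_swapOn_univ] using hf.firstCopy_swapOn univ

lemma integral_secondCopy {f : (ι → E) → ℝ} (hf : Measurable f) :
    ∫ θ, f (secondCopy θ) ∂pairMeasure μ = ∫ x, f x ∂Measure.pi μ := by
  simpa only [firstCopy_swapOn_univ] using integral_firstCopy_swapOn (μ := μ) hf univ

omit [DecidableEq ι] in
lemma integral_pairMeasure {g : (ι → E × E) → ℝ} (hg : BddMeas g) :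
    ∫ θ, g θ ∂pairMeasure μ
      = ∫ x, ∫ y, g (fun k => (x k, y k)) ∂Measure.pi μ ∂Measure.pi μ := by
  have hm : Measurable fun p : (ι → E) × (ι → E) => (fun k => (p.1 k, p.2 k) : ι → E × E) := by
    fun_prop
  have h := measurePreserving_integral_comp
    (measurePreserving_arrowProdEquivProdArrow E E ι μ μ)
    (f := fun p => g fun k => (p.1 k, p.2 k)) (hg.1.comp hm)
  have h2 : ∀ θ : ι → E × E, (fun k => ((MeasurableEquiv.arrowProdEquivProdArrow E E ι θ).1 k,
      (MeasurableEquiv.arrowProdEquivProdArrow E E ι θ).2 k)) = θ := fun θ => rfl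
  simp only [h2] at h
  rw [h, integral_prod _ ((hg.comp hm).integrable _)]

/-! ### Jensen's inequality for partial and signed sums of centred vectors. -/

section Jensen

variable {V : Type*} [NormedAddCommGroup V] [NormedSpace ℝ V] [CompleteSpace V]

omit [DecidableEq ι] [NormedSpace ℝ V] [CompleteSpace V] in
lemma bddMeas_norm_sum {Y : ι → E → V} (hY : ∀ k, StronglyMeasurable (Y k)) {r : ℝ}
    (hr : ∀ k e, ‖Y k e‖ ≤ r) : BddMeas fun x : ι → E => ‖∑ k, Y k (x k)‖ := by
  refine ⟨?_, Fintype.card ι * r, fun x => ?_⟩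
  · have : StronglyMeasurable fun x : ι → E => ∑ k, Y k (x k) :=
      Finset.stronglyMeasurable_fun_sum _ fun k _ => (hY k).comp_measurable (measurable_pi_apply k)
    exact this.norm.measurable
  · rw [abs_norm]
    refine (norm_sum_le _ _).trans ((Finset.sum_le_sum fun k _ => hr k (x k)).trans ?_)
    simp

omit [NormedSpace ℝ V] [CompleteSpace V] in
lemma bddMeas_norm_partial_sum {Y : ι → E → V} (hY : ∀ k, StronglyMeasurable (Y k)) {r : ℝ}
    (hr : ∀ k e, ‖Y k e‖ ≤ r) (S : Finset ι) : BddMeas fun x : ι → E => ‖∑ k ∈ S, Y k (x k)‖ := by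
  have := bddMeas_norm_sum (Y := fun k e => if k ∈ S then Y k e else 0) (r := r)
    (fun k => by
      by_cases h : k ∈ S
      · simpa [h] using hY k
      · simpa [h] using stronglyMeasurable_const)
    (fun k e => by
      have := (norm_nonneg _).trans (hr k e)
      by_cases h : k ∈ S <;> simp [h, hr k e, this])
  simpa [Finset.sum_ite_mem] using this

/-- The partial sum is the conditional expectation of the full sum given the coordinates in `S`,
because the other terms are centred and independent of these; apply Jensen to `‖·‖ ^ p`. -/
lemma integral_norm_partial_sum_pow_le {Y : ι → E → V} (hY : ∀ k, StronglyMeasurable (Y k)) {r : ℝ}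
    (hr : ∀ k e, ‖Y k e‖ ≤ r) (h0 : ∀ k, ∫ e, Y k e ∂μ k = 0) (p : ℕ) (S : Finset ι) :
    ∫ x, ‖∑ k ∈ S, Y k (x k)‖ ^ p ∂Measure.pi μ ≤ ∫ x, ‖∑ k, Y k (x k)‖ ^ p ∂Measure.pi μ := by
  have b1 := (bddMeas_norm_sum hY hr).pow p
  have bS : BddMeas fun x : ι → E => ‖∑ k ∈ S, Y k (x k)‖ ^ p :=
    (bddMeas_norm_partial_sum hY hr S).pow p
  rw [← integral_firstCopy_swapOn b1.1 Sᶜ, integral_pairMeasure (b1.firstCopy_swapOn Sᶜ)]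
  set G : (ι → E) → (ι → E) → V := fun x y => ∑ k, if k ∈ S then Y k (x k) else Y k (y k)
  have hG : ∀ x y : ι → E, ‖∑ k, Y k (firstCopy (swapOn Sᶜ fun k => (x k, y k)) k)‖ ^ p
      = ‖G x y‖ ^ p := by
    intro x y
    congr 2
    refine Finset.sum_congr rfl fun k _ => ?_
    by_cases h : k ∈ S <;> simp [firstCopy, swapOn, h]
  have hYi : ∀ k, Integrable (fun y : ι → E => Y k (y k)) (Measure.pi μ) := fun k =>
    Integrable.of_bound ((hY k).comp_measurable (measurable_pi_apply k)).aestronglyMeasurable r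
      (ae_of_all _ fun y => hr k _)
  have hYint : ∀ k, ∫ y : ι → E, Y k (y k) ∂Measure.pi μ = 0 := by
    intro k
    have h := (measurePreserving_eval μ k)
    have h2 := integral_map (μ := Measure.pi μ) h.measurable.aemeasurable
      (f := Y k) (hY k).aestronglyMeasurable
    rw [h.map_eq, h0] at h2
    exact h2.symm
  have hterm : ∀ (x : ι → E) k, Integrable (fun y : ι → E => if k ∈ S then Y k (x k) else Y k (y k))
      (Measure.pi μ) := fun x k => by
    by_cases h : k ∈ S
    · simp [h]
    · simpa [h] using hYi k
  have hGi : ∀ x, Integrable (G x) (Measure.pi μ) := fun x =>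
    integrable_finsetSum _ fun k _ => hterm x k
  have hGint : ∀ x, ∫ y, G x y ∂Measure.pi μ = ∑ k ∈ S, Y k (x k) := by
    intro x
    simp only [G]
    rw [integral_finsetSum _ fun k _ => hterm x k]
    rw [← Finset.sum_filter_add_sum_filter_not univ (· ∈ S)]
    rw [Finset.sum_congr rfl (g := fun k => Y k (x k)) fun k hk => by
      simp [(Finset.mem_filter.1 hk).2]]
    rw [Finset.sum_congr (s₁ := {k | k ∉ S}) rfl (g := fun _ => (0 : V)) fun k hk => by
      simp [(Finset.mem_filter.1 hk).2, hYint]]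
    simp
  have bG : BddMeas fun θ : ι → E × E => ‖∑ k, Y k (firstCopy (swapOn Sᶜ θ) k)‖ ^ p :=
    b1.firstCopy_swapOn Sᶜ
  have hconv : ∀ x, ‖∑ k ∈ S, Y k (x k)‖ ^ p ≤ ∫ y, ‖G x y‖ ^ p ∂Measure.pi μ := by
    intro x
    rw [← hGint x]
    refine ConvexOn.map_integral_le (g := fun v : V => ‖v‖ ^ p) (s := Set.univ)
      ((convexOn_norm convex_univ).pow (fun _ _ => norm_nonneg _) p)
      (by fun_prop) isClosed_univ (by simp) (hGi x) ?_
    have : BddMeas fun y : ι → E => ‖G x y‖ ^ p := by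
      simp only [← hG]
      exact bG.comp (φ := fun y : ι → E => fun k => (x k, y k)) (by fun_prop)
    exact this.integrable _
  simp only [hG]
  refine integral_mono (bS.integrable _) ?_ hconv
  have bI : BddMeas fun x : ι → E => ∫ y, ‖G x y‖ ^ p ∂Measure.pi μ := by
    obtain ⟨hm, C, hC⟩ := bG
    refine ⟨?_, C, fun x => ?_⟩
    · have : Measurable fun z : (ι → E) × (ι → E) => ‖G z.1 z.2‖ ^ p := by
        simp only [← hG]
        exact hm.comp (by fun_prop :
          Measurable fun z : (ι → E) × (ι → E) => (fun k => (z.1 k, z.2 k) : ι → E × E))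
      exact (this.stronglyMeasurable.integral_prod_right).measurable
    · have := norm_integral_le_of_norm_le_const (μ := Measure.pi μ) (C := C)
        (f := fun y => ‖G x y‖ ^ p) (ae_of_all _ fun y => by
          rw [← hG]; exact hC _)
      simpa using this
  exact bI.integrable _

/-- A signed sum is the difference of the partial sums over `Sᶜ` and `S`, each dominated by the full
sum. Convexity of the power accounts for the factor `2 ^ p`. -/
lemma integral_norm_signed_sum_pow_le {Y : ι → E → V} (hY : ∀ k, StronglyMeasurable (Y k)) {r : ℝ}
    (hr : ∀ k e, ‖Y k e‖ ≤ r) (h0 : ∀ k, ∫ e, Y k e ∂μ k = 0) {p : ℕ} (hp : p ≠ 0) (S : Finset ι) :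
    ∫ x, ‖∑ k, cubeSign S k • Y k (x k)‖ ^ p ∂Measure.pi μ
      ≤ 2 ^ p * ∫ x, ‖∑ k, Y k (x k)‖ ^ p ∂Measure.pi μ := by
  have hB : ∀ A : Finset ι, BddMeas fun x : ι → E => ‖∑ k ∈ A, Y k (x k)‖ ^ p := fun A =>
    (bddMeas_norm_partial_sum hY hr A).pow p
  have hs : BddMeas fun x : ι → E => ‖∑ k, cubeSign S k • Y k (x k)‖ ^ p :=
    (bddMeas_norm_sum (Y := fun k e => cubeSign S k • Y k e) (fun k => (hY k).const_smul _)
      (fun k e => by rw [norm_smul, Real.norm_eq_abs, abs_cubeSign, one_mul]; exact hr k e)).pow p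
  have hpt : ∀ x : ι → E, ‖∑ k, cubeSign S k • Y k (x k)‖ ^ p
      ≤ 2 ^ (p - 1) * (‖∑ k ∈ Sᶜ, Y k (x k)‖ ^ p + ‖∑ k ∈ S, Y k (x k)‖ ^ p) := by
    intro x
    have e : ∑ k, cubeSign S k • Y k (x k) = ∑ k ∈ Sᶜ, Y k (x k) - ∑ k ∈ S, Y k (x k) := by
      rw [← Finset.sum_compl_add_sum S]
      rw [Finset.sum_congr rfl (g := fun k => Y k (x k)) fun k hk => by
        simp [cubeSign, Finset.mem_compl.1 hk]]
      rw [Finset.sum_congr (s₁ := S) rfl (g := fun k => - Y k (x k)) fun k hk => by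
        simp [cubeSign, hk]]
      rw [Finset.sum_neg_distrib, sub_eq_add_neg]
    rw [e]
    exact (pow_le_pow_left₀ (norm_nonneg _) (norm_sub_le _ _) p).trans
      (add_pow_le (norm_nonneg _) (norm_nonneg _) p)
  refine (integral_mono (hs.integrable _)
    ((((hB Sᶜ).integrable _).add ((hB S).integrable _)).const_mul _) hpt).trans ?_
  simp only [Pi.add_apply]
  rw [integral_const_mul, integral_add ((hB Sᶜ).integrable _) ((hB S).integrable _)]
  have h1 := integral_norm_partial_sum_pow_le (μ := μ) hY hr h0 p S
  have h2 := integral_norm_partial_sum_pow_le (μ := μ) hY hr h0 p Sᶜ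
  obtain ⟨n, rfl⟩ := Nat.exists_eq_succ_of_ne_zero hp
  rw [Nat.succ_eq_add_one, Nat.add_sub_cancel, pow_succ 2 n, mul_assoc]
  refine mul_le_mul_of_nonneg_left ?_ (by positivity)
  linarith

end Jensen

/-- The expected supremum of a sum of squares is controlled by the expected supremum of the signed
sum. -/
theorem integral_iSup_sum_sq_le {T : Type*} [Countable T] [Nonempty T] {w : T → ι → E → ℝ}
    (hw : ∀ t k, Measurable (w t k)) {r : ℝ} (hr : ∀ t k e, |w t k e| ≤ r) {s : ℝ}
    (hs : ∀ t, ∑ k, ∫ e, w t k e ^ 2 ∂μ k ≤ s) {b : ℝ}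
    (hb : ∀ S : Finset ι, ∫ x, (⨆ t, ∑ k, cubeSign S k * w t k (x k)) ∂Measure.pi μ ≤ b) (hr0 : 0 ≤ r) :
    ∫ x, (⨆ t, ∑ k, w t k (x k) ^ 2) ∂Measure.pi μ ≤ s + 4 * r * b := by
  have hr2 : ∀ t k e, |w t k e ^ 2| ≤ r ^ 2 := fun t k e => by
    rw [abs_pow]; exact pow_le_pow_left₀ (abs_nonneg _) (hr t k e) 2
  have hsq : ∀ t k, BddMeas fun e => w t k e ^ 2 := fun t k =>
    ⟨(hw t k).pow_const 2, r ^ 2, hr2 t k⟩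
  set A : Finset ι → (ι → E) → ℝ := fun S x => ⨆ t, ∑ k, cubeSign S k * w t k (x k) ^ 2
  set B : Finset ι → (ι → E) → ℝ := fun S x => ⨆ t, ∑ k, cubeSign S k * w t k (x k)
  set D : Finset ι → (ι → E × E) → ℝ := fun S θ =>
    ⨆ t, ∑ k, cubeSign S k * (w t k (θ k).1 ^ 2 - w t k (θ k).2 ^ 2)
  set W : (ι → E) → ℝ := fun x => ⨆ t, ∑ k, w t k (x k) ^ 2
  have bW : BddMeas W := BddMeas.iSup_sum (w := fun t k e => w t k e ^ 2) (fun t k => (hsq t k).1) hr2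
  have bA : ∀ S, BddMeas (A S) := fun S =>
    BddMeas.iSup_sum (w := fun t k e => cubeSign S k * w t k e ^ 2)
      (fun t k => (hsq t k).1.const_mul _) (C := r ^ 2)
      fun t k e => by rw [abs_mul, abs_cubeSign, one_mul]; exact hr2 t k e
  have bB : ∀ S, BddMeas (B S) := fun S =>
    BddMeas.iSup_sum (w := fun t k e => cubeSign S k * w t k e)
      (fun t k => (hw t k).const_mul _) (C := r)
      fun t k e => by rw [abs_mul, abs_cubeSign, one_mul]; exact hr t k e
  have hDabs : ∀ (S : Finset ι) t k (p : E × E),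
      |cubeSign S k * (w t k p.1 ^ 2 - w t k p.2 ^ 2)| ≤ 2 * r ^ 2 := fun S t k p => by
    rw [abs_mul, abs_cubeSign, one_mul]
    refine (abs_sub _ _).trans ?_
    linarith [hr2 t k p.1, hr2 t k p.2]
  have bD : ∀ S, BddMeas (D S) := fun S =>
    BddMeas.iSup_sum (w := fun t k (p : E × E) => cubeSign S k * (w t k p.1 ^ 2 - w t k p.2 ^ 2))
      (fun t k => ((((hsq t k).1.comp measurable_fst).sub
        ((hsq t k).1.comp measurable_snd)).const_mul _)) (C := 2 * r ^ 2) (hDabs S)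
  have hDb : ∀ S (θ : ι → E × E), BddAbove (Set.range fun t => ∑ k, cubeSign S k *
      (w t k (θ k).1 ^ 2 - w t k (θ k).2 ^ 2)) := fun S θ =>
    ⟨∑ _k : ι, 2 * r ^ 2, by
      rintro _ ⟨t, rfl⟩
      exact Finset.sum_le_sum fun k _ => (le_abs_self _).trans (hDabs S t k (θ k))⟩
  have hAb : ∀ S (x : ι → E), BddAbove (Set.range fun t => ∑ k, cubeSign S k * w t k (x k) ^ 2) :=
    fun S x => ⟨∑ _k : ι, r ^ 2, by
      rintro _ ⟨t, rfl⟩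
      refine Finset.sum_le_sum fun k _ => (le_abs_self _).trans ?_
      rw [abs_mul, abs_cubeSign, one_mul]; exact hr2 t k _⟩
  -- For each `t` the mean of the sum of squares is at most `s`; the centred part is an average over
  -- the independent copy, and a supremum of averages is at most the average of the supremum.
  have step1 : ∫ x, W x ∂Measure.pi μ ≤ s + ∫ θ, D ∅ θ ∂pairMeasure μ := by
    have hpair : Measurable fun z : (ι → E) × (ι → E) => (fun k => (z.1 k, z.2 k) : ι → E × E) := by
      fun_prop
    have bI : BddMeas fun x : ι → E => ∫ y, D ∅ (fun k => (x k, y k)) ∂Measure.pi μ := by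
      obtain ⟨hm, C, hC⟩ := bD ∅
      refine ⟨((hm.comp hpair).stronglyMeasurable.integral_prod_right').measurable, C, fun x => ?_⟩
      have := norm_integral_le_of_norm_le_const (μ := Measure.pi μ) (C := C)
        (f := fun y => D ∅ (fun k => (x k, y k))) (ae_of_all _ fun y => hC _)
      simpa using this
    rw [integral_pairMeasure (bD ∅)]
    have hpt : ∀ x, W x ≤ s + ∫ y, D ∅ (fun k => (x k, y k)) ∂Measure.pi μ := by
      intro x
      refine ciSup_le fun t => ?_
      have bt : ∀ k, BddMeas fun y : ι → E => w t k (y k) ^ 2 := fun k =>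
        (hsq t k).comp (measurable_pi_apply k)
      have h1 : ∑ k, w t k (x k) ^ 2 - ∑ k, ∫ e, w t k e ^ 2 ∂μ k
          = ∫ y, (∑ k, (w t k (x k) ^ 2 - w t k (y k) ^ 2)) ∂Measure.pi μ := by
        rw [integral_finsetSum _ fun k _ => ((BddMeas.const _).sub (bt k)).integrable _,
          ← Finset.sum_sub_distrib]
        refine Finset.sum_congr rfl fun k _ => ?_
        rw [integral_sub ((BddMeas.const _).integrable _) ((bt k).integrable _)]
        rw [measurePreserving_integral_comp (measurePreserving_eval μ k)
          (f := fun e => w t k e ^ 2) (hsq t k).1]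
        simp
      have h2 : ∫ y, (∑ k, (w t k (x k) ^ 2 - w t k (y k) ^ 2)) ∂Measure.pi μ
          ≤ ∫ y, D ∅ (fun k => (x k, y k)) ∂Measure.pi μ := by
        refine integral_mono ((BddMeas.sum _ fun k _ => (BddMeas.const _).sub (bt k)).integrable _)
          (((bD ∅).comp (φ := fun y : ι → E => fun k => (x k, y k)) (by fun_prop)).integrable _)
          fun y => ?_
        refine le_trans (le_of_eq ?_) (le_ciSup (hDb ∅ fun k => (x k, y k)) t)
        simp [cubeSign]
      linarith [hs t]
    refine (integral_mono (bW.integrable _) (((BddMeas.const s).add bI).integrable _) hpt).trans ?_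
    rw [integral_add ((BddMeas.const s).integrable _) (bI.integrable _)]
    simp
  -- Exchanging the copies in `S` inserts the signs of `S` without changing the law.
  have step2 : ∀ S : Finset ι, ∫ θ, D ∅ θ ∂pairMeasure μ
      ≤ ∫ x, A S x ∂Measure.pi μ + ∫ x, A Sᶜ x ∂Measure.pi μ := by
    intro S
    have e1 : ∫ θ, D ∅ θ ∂pairMeasure μ = ∫ θ, D S θ ∂pairMeasure μ := by
      rw [← measurePreserving_integral_comp (measurePreserving_swapOn μ S) (bD ∅).1]
      refine integral_congr_ae (ae_of_all _ fun θ => ?_)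
      refine iSup_congr fun t => Finset.sum_congr rfl fun k _ => ?_
      by_cases h : k ∈ S <;> simp [cubeSign, swapOn, h]
    rw [e1, ← measurePreserving_integral_comp (measurePreserving_firstCopy μ) (bA S).1,
      ← integral_secondCopy (bA Sᶜ).1, ← integral_add
        (((bA S).comp measurable_firstCopy).integrable _) ((bA Sᶜ).secondCopy.integrable _)]
    refine integral_mono ((bD S).integrable _) ((((bA S).comp measurable_firstCopy).integrable _).add
      ((bA Sᶜ).secondCopy.integrable _)) fun θ => ?_
    refine ciSup_le fun t => ?_
    have h1 := le_ciSup (hAb S (firstCopy θ)) t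
    have h2 := le_ciSup (hAb Sᶜ (secondCopy θ)) t
    refine le_trans (le_of_eq ?_) (add_le_add h1 h2)
    simp only [cubeSign_compl, ← Finset.sum_add_distrib, firstCopy, secondCopy]
    exact Finset.sum_congr rfl fun k _ => by ring
  -- Contraction at fixed `x`: squaring is `2r`-Lipschitz on `[-r, r]`.
  have step3 : ∀ x, ∑ S : Finset ι, A S x ≤ 2 * r * ∑ S : Finset ι, B S x := by
    intro x
    have := sum_iSup_le_of_abs_sub_le (univ : Finset ι) (C := max (r ^ 2) (2 * r * r))
      (φ := fun k t => w t k (x k) ^ 2) (ψ := fun k t => 2 * r * w t k (x k))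
      (fun k t => (hr2 t k _).trans (le_max_left _ _))
      (fun k t => by
        rw [abs_mul, abs_of_nonneg (by positivity : 0 ≤ 2 * r)]
        exact (mul_le_mul_of_nonneg_left (hr t k _) (by positivity)).trans (le_max_right _ _))
      (fun k t t' => by
        rw [sq_sub_sq, abs_mul, ← mul_sub, abs_mul, abs_of_nonneg (by positivity : 0 ≤ 2 * r)]
        refine mul_le_mul_of_nonneg_right ((abs_add_le _ _).trans ?_) (abs_nonneg _)
        linarith [hr t k (x k), hr t' k (x k)])
      (fun _ => 0) ⟨0, by simp⟩
    simp only [Finset.powerset_univ, zero_add] at this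
    refine this.trans (le_of_eq ?_)
    rw [Finset.mul_sum]
    refine Finset.sum_congr rfl fun S _ => ?_
    rw [Real.mul_iSup_of_nonneg (by positivity)]
    refine iSup_congr fun t => ?_
    rw [Finset.mul_sum]
    exact Finset.sum_congr rfl fun k _ => by ring
  have step4 : ∑ S : Finset ι, ∫ x, A S x ∂Measure.pi μ ≤ 2 * r * ∑ _S : Finset ι, b := by
    rw [← integral_finsetSum _ fun S _ => (bA S).integrable _]
    refine (integral_mono ((BddMeas.sum _ fun S _ => bA S).integrable _)
      (((BddMeas.sum _ fun S _ => bB S).integrable _).const_mul _) step3).trans ?_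
    rw [integral_const_mul, integral_finsetSum _ fun S _ => (bB S).integrable _]
    exact mul_le_mul_of_nonneg_left (Finset.sum_le_sum fun S _ => hb S) (by positivity)
  -- Complementation permutes the sign patterns, so the two halves of `step2` have equal sums. This
  -- `2` and the `2r` of the contraction make up `4r`.
  have step5 : ∑ _S : Finset ι, ∫ θ, D ∅ θ ∂pairMeasure μ
      ≤ 2 * ∑ S : Finset ι, ∫ x, A S x ∂Measure.pi μ := by
    refine (Finset.sum_le_sum fun S _ => step2 S).trans (le_of_eq ?_)
    rw [Finset.sum_add_distrib, two_mul]
    congr 1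
    exact Equiv.sum_comp (Function.Involutive.toPerm (compl : Finset ι → Finset ι)
      compl_involutive) fun S => ∫ x, A S x ∂Measure.pi μ
  have h6 := step5.trans (mul_le_mul_of_nonneg_left step4 two_pos.le)
  rw [Finset.sum_const, Finset.sum_const, nsmul_eq_mul, nsmul_eq_mul] at h6
  have hc : (0 : ℝ) < #(univ : Finset (Finset ι)) := by
    exact_mod_cast Finset.card_pos.2 Finset.univ_nonempty
  have h7 : ∫ θ, D ∅ θ ∂pairMeasure μ ≤ 4 * r * b := by
    refine le_of_mul_le_mul_left ?_ hc
    linarith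
  linarith

end Symmetrization

/-! ### Resolvents of Hermitian matrices -/

section Resolvent

open Matrix

variable {N : ℕ}

/-- The action of a matrix on Euclidean space. -/
noncomputable abbrev act (A : Matrix (Fin N) (Fin N) ℂ) :
    EuclideanSpace ℂ (Fin N) →L[ℂ] EuclideanSpace ℂ (Fin N) :=
  Matrix.toEuclideanCLM (n := Fin N) (𝕜 := ℂ) A

lemma norm_act_le (A : Matrix (Fin N) (Fin N) ℂ) (v : EuclideanSpace ℂ (Fin N)) :
    ‖act A v‖ ≤ ‖A‖ * ‖v‖ := by
  rw [Matrix.cstar_norm_def]; exact (act A).le_opNorm v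

lemma norm_le_of_act_le {A : Matrix (Fin N) (Fin N) ℂ} {C : ℝ} (hC : 0 ≤ C)
    (h : ∀ v, ‖act A v‖ ≤ C * ‖v‖) : ‖A‖ ≤ C := by
  rw [Matrix.cstar_norm_def]; exact (act A).opNorm_le_bound hC h

lemma act_mul_apply (A B : Matrix (Fin N) (Fin N) ℂ) (v : EuclideanSpace ℂ (Fin N)) :
    act (A * B) v = act A (act B v) := by
  simp [act, map_mul]

lemma act_sub_apply (A B : Matrix (Fin N) (Fin N) ℂ) (v : EuclideanSpace ℂ (Fin N)) :
    act (A - B) v = act A v - act B v := by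
  simp [act, map_sub]

lemma inner_act_right (A : Matrix (Fin N) (Fin N) ℂ) (u v : EuclideanSpace ℂ (Fin N)) :
    inner ℂ u (act A v) = inner ℂ (act Aᴴ u) v := by
  have : act Aᴴ = ContinuousLinearMap.adjoint (act A) := by
    rw [← ContinuousLinearMap.star_eq_adjoint, ← map_star]; rfl
  rw [this, ContinuousLinearMap.adjoint_inner_left]

lemma im_inner_act_self {A : Matrix (Fin N) (Fin N) ℂ} (hA : A.IsHermitian)
    (v : EuclideanSpace ℂ (Fin N)) : (inner ℂ v (act A v)).im = 0 := by
  have h := inner_act_right A v v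
  rw [hA.eq] at h
  exact Complex.conj_eq_iff_im.1 ((inner_conj_symm _ _).trans h.symm)

/-- The resolvent `(z - A)⁻¹`. -/
noncomputable def resolv (z : ℂ) (A : Matrix (Fin N) (Fin N) ℂ) : Matrix (Fin N) (Fin N) ℂ :=
  (z • (1 : Matrix (Fin N) (Fin N) ℂ) - A)⁻¹

/-- The quadratic form of a Hermitian `A` is real, so `⟨v, (z - A) v⟩` has imaginary part `z.im *
‖v‖ ^ 2`; conclude by Cauchy–Schwarz. -/
lemma im_mul_norm_le {A : Matrix (Fin N) (Fin N) ℂ} (hA : A.IsHermitian) {z : ℂ}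
    (v : EuclideanSpace ℂ (Fin N)) :
    z.im * ‖v‖ ≤ ‖act (z • (1 : Matrix (Fin N) (Fin N) ℂ) - A) v‖ := by
  rcases eq_or_ne v 0 with rfl | hv
  · simp
  have hv' : 0 < ‖v‖ := norm_pos_iff.2 hv
  have h1 : inner ℂ v (act (z • (1 : Matrix (Fin N) (Fin N) ℂ) - A) v)
      = z * (‖v‖ : ℂ) ^ 2 - inner ℂ v (act A v) := by
    rw [act_sub_apply, inner_sub_right]
    simp [act, map_smul, inner_smul_right, inner_self_eq_norm_sq_to_K]
  have h2 : (inner ℂ v (act (z • (1 : Matrix (Fin N) (Fin N) ℂ) - A) v)).im = z.im * ‖v‖ ^ 2 := by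
    rw [h1, Complex.sub_im, im_inner_act_self hA, sub_zero, ← Complex.ofReal_pow,
      Complex.im_mul_ofReal]
  have h3 : z.im * ‖v‖ ^ 2 ≤ ‖v‖ * ‖act (z • (1 : Matrix (Fin N) (Fin N) ℂ) - A) v‖ := by
    rw [← h2]
    exact (le_abs_self _).trans ((Complex.abs_im_le_norm _).trans (norm_inner_le_norm _ _))
  refine le_of_mul_le_mul_left ?_ hv'
  linarith

variable {z : ℂ} {A A' : Matrix (Fin N) (Fin N) ℂ}

lemma isUnit_det_sub (hz : 0 < z.im) (hA : A.IsHermitian) :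
    IsUnit (z • (1 : Matrix (Fin N) (Fin N) ℂ) - A).det := by
  rw [← Matrix.isUnit_iff_isUnit_det, ← Matrix.mulVec_injective_iff_isUnit]
  refine (injective_iff_map_eq_zero
    (Matrix.mulVecLin (z • (1 : Matrix (Fin N) (Fin N) ℂ) - A))).2 fun v hv => ?_
  have h1 := im_mul_norm_le hA (z := z) (WithLp.toLp 2 v)
  have h2 : act (z • (1 : Matrix (Fin N) (Fin N) ℂ) - A) (WithLp.toLp 2 v) = 0 := by
    rw [act, Matrix.toEuclideanCLM_toLp]
    rw [Matrix.mulVecLin_apply] at hv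
    rw [hv]; rfl
  rw [h2, norm_zero] at h1
  have h3 : ‖(WithLp.toLp 2 v : EuclideanSpace ℂ (Fin N))‖ = 0 :=
    le_antisymm (by nlinarith [norm_nonneg (WithLp.toLp 2 v : EuclideanSpace ℂ (Fin N))])
      (norm_nonneg _)
  simpa using h3

lemma norm_resolv_le (hz : 0 < z.im) (hA : A.IsHermitian) : ‖resolv z A‖ ≤ z.im⁻¹ := by
  refine norm_le_of_act_le (by positivity) fun v => ?_
  have h := im_mul_norm_le hA (z := z) (act (resolv z A) v)
  rw [← act_mul_apply, resolv, Matrix.mul_nonsing_inv _ (isUnit_det_sub hz hA)] at h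
  rw [inv_mul_eq_div, le_div_iff₀ hz, mul_comm]
  simpa [act, resolv] using h

lemma resolv_sub_resolv (hz : 0 < z.im) (hA : A.IsHermitian) (hA' : A'.IsHermitian) :
    resolv z A - resolv z A' = resolv z A * (A - A') * resolv z A' := by
  have e : A - A' = (z • (1 : Matrix (Fin N) (Fin N) ℂ) - A')
      - (z • (1 : Matrix (Fin N) (Fin N) ℂ) - A) := by abel
  rw [e, mul_sub, sub_mul, resolv, resolv, Matrix.nonsing_inv_mul _ (isUnit_det_sub hz hA),
    Matrix.mul_assoc, Matrix.mul_nonsing_inv _ (isUnit_det_sub hz hA')]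
  simp

/-- Iterating the resolvent identity gives `G - G' = G D G - G D G D G'`. The first-order term stays
a bilinear form in vectors depending on `A` alone, so these vectors do not change when `A'` ranges
over the resampled matrices; the perturbed `G'` enters only through its norm. -/
lemma resolv_increment_sq_le (hz : 0 < z.im) (hA : A.IsHermitian) (hA' : A'.IsHermitian)
    {u v : EuclideanSpace ℂ (Fin N)} (hv : ‖v‖ = 1) {d : ℝ}
    (hd : ‖A - A'‖ ≤ d) :
    ((inner ℂ u (act (resolv z A) v)).re - (inner ℂ u (act (resolv z A') v)).re) ^ 2
      ≤ 2 * (inner ℂ (act (resolv z A)ᴴ u) (act (A - A') (act (resolv z A) v))).re ^ 2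
        + 2 * (d / z.im ^ 2) ^ 2 * ‖act (A - A') (act (resolv z A)ᴴ u)‖ ^ 2 := by
  set G := resolv z A
  set G' := resolv z A'
  set D := A - A'
  have hD : Dᴴ = D := by simp [D, Matrix.conjTranspose_sub, hA.eq, hA'.eq]
  have h1 : G - G' = G * D * G - G * D * (G * D * G') := by
    have h := resolv_sub_resolv hz hA hA'
    have h' : G' = G - G * D * G' := by rw [← h]; abel
    calc G - G' = G * D * G' := h
      _ = G * D * (G - G * D * G') := by rw [← h']
      _ = _ := by rw [mul_sub]
  have h2 : (inner ℂ u (act G v)).re - (inner ℂ u (act G' v)).re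
      = (inner ℂ (act Gᴴ u) (act D (act G v))).re
        - (inner ℂ (act D (act Gᴴ u)) (act (G * D * G') v)).re := by
    rw [← Complex.sub_re, ← inner_sub_right, ← act_sub_apply, h1, act_sub_apply, inner_sub_right,
      Complex.sub_re, act_mul_apply, act_mul_apply, inner_act_right G, act_mul_apply (G * D),
      act_mul_apply G D, inner_act_right G,
      inner_act_right D _ (act (G * D * G') v), hD]
  have h3 : |(inner ℂ (act D (act Gᴴ u)) (act (G * D * G') v)).re|
      ≤ (d / z.im ^ 2) * ‖act D (act Gᴴ u)‖ := by
    refine (Complex.abs_re_le_norm _).trans ((norm_inner_le_norm _ _).trans ?_)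
    rw [mul_comm]
    refine mul_le_mul_of_nonneg_right ?_ (norm_nonneg _)
    have hG := norm_resolv_le hz hA
    have hG' := norm_resolv_le hz hA'
    have hi : 0 ≤ z.im⁻¹ := by positivity
    have hd0 : 0 ≤ d := (norm_nonneg _).trans hd
    calc ‖act (G * D * G') v‖ ≤ ‖G * D * G'‖ * ‖v‖ := norm_act_le _ _
      _ ≤ (‖G‖ * ‖D‖ * ‖G'‖) * ‖v‖ := by
        gcongr
        exact (norm_mul_le _ _).trans (mul_le_mul_of_nonneg_right (norm_mul_le _ _) (norm_nonneg _))
      _ ≤ (z.im⁻¹ * d * z.im⁻¹) * 1 := by rw [hv]; gcongr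
      _ = d / z.im ^ 2 := by field_simp
  rw [h2]
  have h4 := sq_le_sq' (abs_le.1 h3).1 (abs_le.1 h3).2
  rw [mul_pow] at h4
  nlinarith [sq_nonneg ((inner ℂ (act Gᴴ u) (act D (act G v))).re
    + (inner ℂ (act D (act Gᴴ u)) (act (G * D * G') v)).re)]

lemma norm_conjTranspose_resolv_le (hz : 0 < z.im) (hA : A.IsHermitian) :
    ‖(resolv z A)ᴴ‖ ≤ z.im⁻¹ := by
  rw [Matrix.l2_opNorm_conjTranspose]; exact norm_resolv_le hz hA

/-- The inverse is the inverse determinant times the adjugate, which is measurable even where the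
matrix is singular. -/
lemma stronglyMeasurable_resolv {α : Type*} [MeasurableSpace α]
    {X : α → Matrix (Fin N) (Fin N) ℂ} (hX : StronglyMeasurable X) (z : ℂ) :
    StronglyMeasurable fun x => resolv z (X x) := by
  have h1 : StronglyMeasurable fun x => z • (1 : Matrix (Fin N) (Fin N) ℂ) - X x :=
    stronglyMeasurable_const.sub hX
  have hdet : StronglyMeasurable fun x => (z • (1 : Matrix (Fin N) (Fin N) ℂ) - X x).det :=
    (Continuous.matrix_det continuous_id).comp_stronglyMeasurable h1
  have hadj : StronglyMeasurable fun x => (z • (1 : Matrix (Fin N) (Fin N) ℂ) - X x).adjugate :=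
    (Continuous.matrix_adjugate continuous_id).comp_stronglyMeasurable h1
  simp only [resolv, Matrix.inv_def, Ring.inverse_eq_inv']
  exact hdet.measurable.inv.stronglyMeasurable.smul hadj

lemma continuous_act_apply (v : EuclideanSpace ℂ (Fin N)) :
    Continuous fun A : Matrix (Fin N) (Fin N) ℂ => act A v := by
  refine (LinearMap.continuous_of_finiteDimensional
    ({ toFun := fun A => act A v, map_add' := ?_, map_smul' := ?_ } :
      Matrix (Fin N) (Fin N) ℂ →ₗ[ℂ] EuclideanSpace ℂ (Fin N)))
  · intro A B; simp [act]
  · intro c A; simp [act]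

end Resolvent

/-! ### Moments of resolvent entries of sums of independent bounded matrices -/

section Core

open Finset
open scoped Matrix

/-- A dense sequence of pairs of vectors in the unit ball. -/
noncomputable def unitSeq (N n : ℕ) : EuclideanSpace ℂ (Fin N) × EuclideanSpace ℂ (Fin N) :=
  haveI : Nonempty (Metric.closedBall (0 : EuclideanSpace ℂ (Fin N)) 1) := ⟨⟨0, by simp⟩⟩
  let p := TopologicalSpace.denseSeq (Metric.closedBall (0 : EuclideanSpace ℂ (Fin N)) 1
    × Metric.closedBall (0 : EuclideanSpace ℂ (Fin N)) 1) n
  (p.1, p.2)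

lemma norm_unitSeq_fst_le (N n : ℕ) : ‖(unitSeq N n).1‖ ≤ 1 := by
  have : Nonempty (Metric.closedBall (0 : EuclideanSpace ℂ (Fin N)) 1) := ⟨⟨0, by simp⟩⟩
  exact mem_closedBall_zero_iff.1 (TopologicalSpace.denseSeq
    (Metric.closedBall (0 : EuclideanSpace ℂ (Fin N)) 1
    × Metric.closedBall (0 : EuclideanSpace ℂ (Fin N)) 1) n).1.2

lemma norm_unitSeq_snd_le (N n : ℕ) : ‖(unitSeq N n).2‖ ≤ 1 := by
  have : Nonempty (Metric.closedBall (0 : EuclideanSpace ℂ (Fin N)) 1) := ⟨⟨0, by simp⟩⟩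
  exact mem_closedBall_zero_iff.1 (TopologicalSpace.denseSeq
    (Metric.closedBall (0 : EuclideanSpace ℂ (Fin N)) 1
    × Metric.closedBall (0 : EuclideanSpace ℂ (Fin N)) 1) n).2.2

variable {N : ℕ}

/-- By density and continuity, a countable supremum, which is measurable, dominates all values on
the unit balls. This covers the random vectors `G* u` and `G v` after rescaling. -/
lemma le_iSup_unitSeq {φ : EuclideanSpace ℂ (Fin N) × EuclideanSpace ℂ (Fin N) → ℝ}
    (hφ : Continuous φ) (hb : BddAbove (Set.range fun n => φ (unitSeq N n)))
    {a b : EuclideanSpace ℂ (Fin N)} (ha : ‖a‖ ≤ 1) (hb' : ‖b‖ ≤ 1) :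
    φ (a, b) ≤ ⨆ n, φ (unitSeq N n) := by
  have : Nonempty (Metric.closedBall (0 : EuclideanSpace ℂ (Fin N)) 1) := ⟨⟨0, by simp⟩⟩
  set K := Metric.closedBall (0 : EuclideanSpace ℂ (Fin N)) 1
  set ψ : K × K → ℝ := fun p => φ (p.1, p.2)
  have hψ : Continuous ψ := by fun_prop
  have hcl : IsClosed {p : K × K | ψ p ≤ ⨆ n, φ (unitSeq N n)} :=
    isClosed_le hψ continuous_const
  have hsub : Set.range (TopologicalSpace.denseSeq (K × K))
      ⊆ {p : K × K | ψ p ≤ ⨆ n, φ (unitSeq N n)} := by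
    rintro _ ⟨n, rfl⟩
    exact le_ciSup hb n
  have hd := (TopologicalSpace.denseRange_denseSeq (K × K)).closure_eq
  have h2 := hcl.closure_subset_iff.2 hsub
  have hmem : ((⟨a, mem_closedBall_zero_iff.2 ha⟩, ⟨b, mem_closedBall_zero_iff.2 hb'⟩) : K × K)
      ∈ closure (Set.range (TopologicalSpace.denseSeq (K × K))) := by
    rw [hd]; trivial
  exact h2 hmem

lemma abs_re_inner_act_le (A : Matrix (Fin N) (Fin N) ℂ) {a : EuclideanSpace ℂ (Fin N)}
    (ha : ‖a‖ ≤ 1) (b : EuclideanSpace ℂ (Fin N)) : |(inner ℂ a (act A b)).re| ≤ ‖act A b‖ := by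
  refine (Complex.abs_re_le_norm _).trans ((norm_inner_le_norm _ _).trans ?_)
  exact (mul_le_mul_of_nonneg_right ha (norm_nonneg _)).trans (one_mul _).le

variable {ι : Type*} [Fintype ι] {E : Type*}

/-- The largest sum of squared bilinear forms over pairs of vectors in the unit ball. -/
noncomputable def formSup (B : ι → E → Matrix (Fin N) (Fin N) ℂ) (x : ι → E) : ℝ :=
  ⨆ n, ∑ k, (inner ℂ (unitSeq N n).1 (act (B k (x k)) (unitSeq N n).2)).re ^ 2

/-- The largest sum of squared images over vectors in the unit ball. -/
noncomputable def squareSup (B : ι → E → Matrix (Fin N) (Fin N) ℂ) (x : ι → E) : ℝ :=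
  ⨆ n, ∑ k, ‖act (B k (x k)) (unitSeq N n).1‖ ^ 2

section Bounds

variable {B : ι → E → Matrix (Fin N) (Fin N) ℂ} {r : ℝ} (hBr : ∀ k e, ‖B k e‖ ≤ r)
include hBr

omit [Fintype ι] in
lemma norm_act_unit_le (k : ι) (e : E) {b : EuclideanSpace ℂ (Fin N)} (hb : ‖b‖ ≤ 1) :
    ‖act (B k e) b‖ ≤ r := by
  have h0 : 0 ≤ r := (norm_nonneg _).trans (hBr k e)
  refine (norm_act_le _ _).trans ?_
  calc ‖B k e‖ * ‖b‖ ≤ r * 1 := mul_le_mul (hBr k e) hb (norm_nonneg _) h0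
    _ = r := mul_one r

lemma sum_re_inner_sq_le_formSup (x : ι → E) {a b : EuclideanSpace ℂ (Fin N)} {c : ℝ}
    (hc : 0 < c) (ha : ‖a‖ ≤ c) (hb : ‖b‖ ≤ c) :
    ∑ k, (inner ℂ a (act (B k (x k)) b)).re ^ 2 ≤ c ^ 4 * formSup B x := by
  have hbd : BddAbove (Set.range fun n => ∑ k,
      (inner ℂ (unitSeq N n).1 (act (B k (x k)) (unitSeq N n).2)).re ^ 2) := by
    refine ⟨∑ _k : ι, r ^ 2, ?_⟩
    rintro _ ⟨n, rfl⟩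
    refine Finset.sum_le_sum fun k _ => ?_
    rw [← sq_abs]
    exact pow_le_pow_left₀ (abs_nonneg _) ((abs_re_inner_act_le _ (norm_unitSeq_fst_le N n)
      _).trans (norm_act_unit_le hBr k _ (norm_unitSeq_snd_le N n))) 2
  have key := le_iSup_unitSeq (φ := fun p => ∑ k, (inner ℂ p.1 (act (B k (x k)) p.2)).re ^ 2)
    (by fun_prop) hbd (a := (c⁻¹ : ℂ) • a) (b := (c⁻¹ : ℂ) • b)
    (by rw [norm_smul, norm_inv, Complex.norm_of_nonneg hc.le, inv_mul_le_iff₀ hc]; simpa using ha)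
    (by rw [norm_smul, norm_inv, Complex.norm_of_nonneg hc.le, inv_mul_le_iff₀ hc]; simpa using hb)
  have e : ∀ k, (inner ℂ a (act (B k (x k)) b)).re ^ 2
      = c ^ 4 * (inner ℂ ((c⁻¹ : ℂ) • a) (act (B k (x k)) ((c⁻¹ : ℂ) • b))).re ^ 2 := by
    intro k
    rw [map_smul, inner_smul_left, inner_smul_right, map_inv₀, Complex.conj_ofReal,
      ← Complex.ofReal_inv, Complex.re_ofReal_mul, Complex.re_ofReal_mul]
    field_simp
  rw [Finset.sum_congr rfl fun k _ => e k, ← Finset.mul_sum]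
  exact mul_le_mul_of_nonneg_left key (by positivity)

lemma sum_norm_sq_le_squareSup (x : ι → E) {a : EuclideanSpace ℂ (Fin N)} {c : ℝ}
    (hc : 0 < c) (ha : ‖a‖ ≤ c) :
    ∑ k, ‖act (B k (x k)) a‖ ^ 2 ≤ c ^ 2 * squareSup B x := by
  have hbd : BddAbove (Set.range fun n => ∑ k, ‖act (B k (x k)) (unitSeq N n).1‖ ^ 2) := by
    refine ⟨∑ _k : ι, r ^ 2, ?_⟩
    rintro _ ⟨n, rfl⟩
    exact Finset.sum_le_sum fun k _ => pow_le_pow_left₀ (norm_nonneg _)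
      (norm_act_unit_le hBr k _ (norm_unitSeq_fst_le N n)) 2
  have key := le_iSup_unitSeq (φ := fun p => ∑ k, ‖act (B k (x k)) p.1‖ ^ 2)
    (by fun_prop) hbd (a := (c⁻¹ : ℂ) • a) (b := 0)
    (by rw [norm_smul, norm_inv, Complex.norm_of_nonneg hc.le, inv_mul_le_iff₀ hc]; simpa using ha)
    (by simp)
  have e : ∀ k, ‖act (B k (x k)) a‖ ^ 2
      = c ^ 2 * ‖act (B k (x k)) ((c⁻¹ : ℂ) • a)‖ ^ 2 := by
    intro k
    rw [map_smul, norm_smul, norm_inv, Complex.norm_of_nonneg hc.le]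
    field_simp
  rw [Finset.sum_congr rfl fun k _ => e k, ← Finset.mul_sum]
  exact mul_le_mul_of_nonneg_left key (by positivity)

end Bounds

section Pointwise

variable [DecidableEq ι]

/-- The real part of the resolvent entry of a sum. -/
noncomputable def resolvRe (u v : EuclideanSpace ℂ (Fin N)) (z : ℂ)
    (Z₀ : Matrix (Fin N) (Fin N) ℂ) (B : ι → E → Matrix (Fin N) (Fin N) ℂ) (x : ι → E) : ℝ :=
  (inner ℂ u (act (resolv z (Z₀ + ∑ k, B k (x k))) v)).re

omit [DecidableEq ι] in
lemma isHermitian_add_sum {Z₀ : Matrix (Fin N) (Fin N) ℂ} (h₀ : Z₀.IsHermitian)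
    {B : ι → E → Matrix (Fin N) (Fin N) ℂ} (hBh : ∀ k e, (B k e).IsHermitian) (x : ι → E) :
    (Z₀ + ∑ k, B k (x k)).IsHermitian := by
  rw [Matrix.IsHermitian, Matrix.conjTranspose_add, Matrix.conjTranspose_sum, h₀.eq]
  simp only [(hBh _ _).eq]

/-- Resampling coordinate `k` changes the matrix by the difference of two summands, of norm at most
`2r`. The vectors `a` and `b` are the same for every `k`, so summing over `k` yields forms at a
single pair of vectors, bounded by the suprema. -/
lemma efronStein_resolvRe_le {Z₀ : Matrix (Fin N) (Fin N) ℂ} (h₀ : Z₀.IsHermitian)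
    {B : ι → E → Matrix (Fin N) (Fin N) ℂ} (hBh : ∀ k e, (B k e).IsHermitian) {r : ℝ}
    (hBr : ∀ k e, ‖B k e‖ ≤ r) {z : ℂ} (hz : 0 < z.im)
    {u v : EuclideanSpace ℂ (Fin N)} (hu : ‖u‖ = 1) (hv : ‖v‖ = 1) (θ : ι → E × E) :
    efronStein (resolvRe u v z Z₀ B) θ
      ≤ 4 * z.im⁻¹ ^ 4 * (formSup B (firstCopy θ) + formSup B (secondCopy θ))
        + 16 * r ^ 2 * z.im⁻¹ ^ 6 * (squareSup B (firstCopy θ) + squareSup B (secondCopy θ)) := by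
  set X := Z₀ + ∑ k, B k (firstCopy θ k)
  have hX : X.IsHermitian := isHermitian_add_sum h₀ hBh _
  set a := act (resolv z X)ᴴ u
  set b := act (resolv z X) v
  have hc : 0 < z.im⁻¹ := by positivity
  have ha : ‖a‖ ≤ z.im⁻¹ := by
    refine (norm_act_le _ _).trans ?_
    rw [hu, mul_one]; exact norm_conjTranspose_resolv_le hz hX
  have hb : ‖b‖ ≤ z.im⁻¹ := by
    refine (norm_act_le _ _).trans ?_
    rw [hv, mul_one]; exact norm_resolv_le hz hX
  have hk : ∀ k, (resolvRe u v z Z₀ B (firstCopy θ)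
        - resolvRe u v z Z₀ B (firstCopy (swapOn {k} θ))) ^ 2
      ≤ 4 * ((inner ℂ a (act (B k (firstCopy θ k)) b)).re ^ 2
          + (inner ℂ a (act (B k (secondCopy θ k)) b)).re ^ 2)
        + 16 * r ^ 2 * z.im⁻¹ ^ 4 * (‖act (B k (firstCopy θ k)) a‖ ^ 2
          + ‖act (B k (secondCopy θ k)) a‖ ^ 2) := by
    intro k
    set X' := Z₀ + ∑ j, B j (firstCopy (swapOn {k} θ) j)
    have hX' : X'.IsHermitian := isHermitian_add_sum h₀ hBh _
    have hD : X - X' = B k (firstCopy θ k) - B k (secondCopy θ k) := by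
      simp only [X, X', add_sub_add_left_eq_sub, ← Finset.sum_sub_distrib]
      rw [Finset.sum_eq_single k]
      · simp [firstCopy, secondCopy, swapOn]
      · intro j _ hj
        simp [firstCopy, swapOn, hj]
      · simp
    have hd : ‖X - X'‖ ≤ 2 * r := by
      rw [hD]
      refine (norm_sub_le _ _).trans ?_
      linarith [hBr k (firstCopy θ k), hBr k (secondCopy θ k)]
    have h := resolv_increment_sq_le hz hX hX' (u := u) hv hd
    refine h.trans ?_
    rw [hD, act_sub_apply, act_sub_apply, inner_sub_right, Complex.sub_re]
    have h1 : ∀ p q : ℝ, (p - q) ^ 2 ≤ 2 * (p ^ 2 + q ^ 2) := fun p q => by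
      nlinarith [sq_nonneg (p + q)]
    have h2 : ‖act (B k (firstCopy θ k)) a - act (B k (secondCopy θ k)) a‖ ^ 2
        ≤ 2 * (‖act (B k (firstCopy θ k)) a‖ ^ 2 + ‖act (B k (secondCopy θ k)) a‖ ^ 2) := by
      refine (pow_le_pow_left₀ (norm_nonneg _) (norm_sub_le _ _) 2).trans ?_
      nlinarith [sq_nonneg (‖act (B k (firstCopy θ k)) a‖ - ‖act (B k (secondCopy θ k)) a‖)]
    have h3 : 2 * (2 * r / z.im ^ 2) ^ 2 = 8 * r ^ 2 * z.im⁻¹ ^ 4 := by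
      field_simp; ring
    rw [h3]
    have h4 := mul_le_mul_of_nonneg_left h2 (by positivity : 0 ≤ 8 * r ^ 2 * z.im⁻¹ ^ 4)
    have h5 := h1 (inner ℂ a (act (B k (firstCopy θ k)) b)).re
      (inner ℂ a (act (B k (secondCopy θ k)) b)).re
    linarith
  refine (Finset.sum_le_sum fun k _ => hk k).trans ?_
  rw [Finset.sum_add_distrib, ← Finset.mul_sum, ← Finset.mul_sum, Finset.sum_add_distrib,
    Finset.sum_add_distrib]
  have f1 := sum_re_inner_sq_le_formSup hBr (firstCopy θ) hc ha hb
  have f2 := sum_re_inner_sq_le_formSup hBr (secondCopy θ) hc ha hb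
  have g1 := sum_norm_sq_le_squareSup hBr (firstCopy θ) hc ha
  have g2 := sum_norm_sq_le_squareSup hBr (secondCopy θ) hc ha
  have g3 := mul_le_mul_of_nonneg_left (add_le_add g1 g2)
    (by positivity : 0 ≤ 16 * r ^ 2 * z.im⁻¹ ^ 4)
  calc _ ≤ 4 * (z.im⁻¹ ^ 4 * formSup B (firstCopy θ) + z.im⁻¹ ^ 4 * formSup B (secondCopy θ))
      + 16 * r ^ 2 * z.im⁻¹ ^ 4 * (z.im⁻¹ ^ 2 * squareSup B (firstCopy θ)
        + z.im⁻¹ ^ 2 * squareSup B (secondCopy θ)) := by linarith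
    _ = _ := by ring

end Pointwise

end Core

/-! ### Means and moments of the suprema of quadratic sums. -/

section CoreMoments

open Finset

variable {N : ℕ} {ι : Type*} [Fintype ι] {E : Type*} [MeasurableSpace E]
  {μ : ι → Measure E} [∀ k, IsProbabilityMeasure (μ k)]

/-- Evaluation of matrices at a vector. -/
noncomputable def actCLM (v : EuclideanSpace ℂ (Fin N)) :
    Matrix (Fin N) (Fin N) ℂ →L[ℂ] EuclideanSpace ℂ (Fin N) where
  toFun A := act A v
  map_add' A B := by simp [act]
  map_smul' c A := by simp [act]
  cont := continuous_act_apply v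

variable {B : ι → E → Matrix (Fin N) (Fin N) ℂ} (hBm : ∀ k, StronglyMeasurable (B k)) {r : ℝ}
  (hBr : ∀ k e, ‖B k e‖ ≤ r)
include hBm

omit [Fintype ι] in
lemma stronglyMeasurable_act (k : ι) (v : EuclideanSpace ℂ (Fin N)) :
    StronglyMeasurable fun e => act (B k e) v :=
  (continuous_act_apply v).comp_stronglyMeasurable (hBm k)

omit [Fintype ι] in
lemma measurable_re_inner_act (k : ι) (a b : EuclideanSpace ℂ (Fin N)) :
    Measurable fun e => (inner ℂ a (act (B k e) b)).re := by
  have : Continuous fun v : EuclideanSpace ℂ (Fin N) => (inner ℂ a v).re := by fun_prop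
  exact (this.comp_stronglyMeasurable (stronglyMeasurable_act hBm k b)).measurable

include hBr

omit [Fintype ι] in
lemma integral_act_eq_zero (hB0 : ∀ k, ∫ e, B k e ∂μ k = 0) (k : ι)
    (v : EuclideanSpace ℂ (Fin N)) : ∫ e, act (B k e) v ∂μ k = 0 := by
  have hi : Integrable (B k) (μ k) :=
    Integrable.of_bound (hBm k).aestronglyMeasurable r (ae_of_all _ (hBr k))
  have := (actCLM v).integral_comp_comm hi
  rw [hB0, map_zero] at this
  exact this

omit [Fintype ι] in
lemma bddMeas_norm_act_sq (k : ι) (v : EuclideanSpace ℂ (Fin N)) :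
    BddMeas fun e => ‖act (B k e) v‖ ^ 2 :=
  BddMeas.pow ⟨(stronglyMeasurable_act hBm k v).norm.measurable, r * ‖v‖, fun e => by
    rw [abs_norm]
    exact (norm_act_le _ _).trans (mul_le_mul_of_nonneg_right (hBr k e) (norm_nonneg _))⟩ 2

lemma bddMeas_formSup : BddMeas (formSup B) := by
  refine BddMeas.iSup_sum (w := fun n k e =>
    (inner ℂ (unitSeq N n).1 (act (B k e) (unitSeq N n).2)).re ^ 2)
    (fun n k => (measurable_re_inner_act hBm k _ _).pow_const 2) (C := r ^ 2) fun n k e => ?_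
  rw [abs_pow]
  exact pow_le_pow_left₀ (abs_nonneg _) ((abs_re_inner_act_le _ (norm_unitSeq_fst_le N n) _).trans
    (norm_act_unit_le hBr k _ (norm_unitSeq_snd_le N n))) 2

lemma bddMeas_squareSup : BddMeas (squareSup B) := by
  refine BddMeas.iSup_sum (w := fun n k e => ‖act (B k e) (unitSeq N n).1‖ ^ 2)
    (fun n k => (bddMeas_norm_act_sq hBm hBr k _).1) (C := r ^ 2) fun n k e => ?_
  rw [abs_of_nonneg (by positivity)]
  exact pow_le_pow_left₀ (norm_nonneg _) (norm_act_unit_le hBr k _ (norm_unitSeq_fst_le N n)) 2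

lemma integral_formSup_pow_le (q : ℕ) :
    ∫ x, formSup B x ^ q ∂Measure.pi μ ≤ (∫ x, formSup B x ∂Measure.pi μ + q * r ^ 2) ^ q := by
  classical
  refine integral_iSup_sum_pow_le (w := fun n k e =>
    (inner ℂ (unitSeq N n).1 (act (B k e) (unitSeq N n).2)).re ^ 2)
    (fun n k => (measurable_re_inner_act hBm k _ _).pow_const 2) (by positivity)
    (fun n k e => sq_nonneg _) (fun n k e => ?_) q
  rw [← sq_abs]
  exact pow_le_pow_left₀ (abs_nonneg _) ((abs_re_inner_act_le _ (norm_unitSeq_fst_le N n) _).trans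
    (norm_act_unit_le hBr k _ (norm_unitSeq_snd_le N n))) 2

lemma integral_squareSup_pow_le (q : ℕ) :
    ∫ x, squareSup B x ^ q ∂Measure.pi μ ≤ (∫ x, squareSup B x ∂Measure.pi μ + q * r ^ 2) ^ q := by
  classical
  exact integral_iSup_sum_pow_le (w := fun n k e => ‖act (B k e) (unitSeq N n).1‖ ^ 2)
    (fun n k => (bddMeas_norm_act_sq hBm hBr k _).1) (by positivity)
    (fun n k e => sq_nonneg _) (fun n k e =>
      pow_le_pow_left₀ (norm_nonneg _) (norm_act_unit_le hBr k _ (norm_unitSeq_fst_le N n)) 2) q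

variable (hB0 : ∀ k, ∫ e, B k e ∂μ k = 0)
include hB0

/-- Averaging the squared norm of the signed sum over all signs gives the left side; removing the
signs costs `2 ^ 2`. -/
lemma sum_integral_norm_act_sq_le (v : EuclideanSpace ℂ (Fin N)) :
    ∑ k, ∫ e, ‖act (B k e) v‖ ^ 2 ∂μ k
      ≤ 4 * ∫ x, ‖∑ k, act (B k (x k)) v‖ ^ 2 ∂Measure.pi μ := by
  classical
  have hY := fun k => stronglyMeasurable_act hBm k v
  have hr : ∀ k e, ‖act (B k e) v‖ ≤ r * ‖v‖ := fun k e =>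
    (norm_act_le _ _).trans (mul_le_mul_of_nonneg_right (hBr k e) (norm_nonneg _))
  have h0 := fun k => integral_act_eq_zero hBm hBr hB0 k v
  have hs := fun S : Finset ι => integral_norm_signed_sum_pow_le (μ := μ) hY hr h0 two_ne_zero S
  have bS : ∀ S : Finset ι, BddMeas fun x : ι → E => ‖∑ k, cubeSign S k • act (B k (x k)) v‖ ^ 2 :=
    fun S => (bddMeas_norm_sum (Y := fun k e => cubeSign S k • act (B k e) v)
      (fun k => (hY k).fun_const_smul _)
      (fun k e => by rw [norm_smul, Real.norm_eq_abs, abs_cubeSign, one_mul]; exact hr k e)).pow 2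
  have bk : ∀ k, BddMeas fun x : ι → E => ‖act (B k (x k)) v‖ ^ 2 := fun k =>
    (bddMeas_norm_act_sq hBm hBr k v).comp (measurable_pi_apply k)
  have h1 : ∫ x, ∑ S : Finset ι, ‖∑ k, cubeSign S k • act (B k (x k)) v‖ ^ 2 ∂Measure.pi μ
      = 2 ^ #(univ : Finset ι) * ∑ k, ∫ e, ‖act (B k e) v‖ ^ 2 ∂μ k := by
    have : ∀ x : ι → E, ∑ S : Finset ι, ‖∑ k, cubeSign S k • act (B k (x k)) v‖ ^ 2
        = 2 ^ #(univ : Finset ι) * ∑ k, ‖act (B k (x k)) v‖ ^ 2 := fun x => by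
      have := sum_norm_add_signed_sum_sq univ (fun k => act (B k (x k)) v) 0
      simpa using this
    simp only [this]
    rw [integral_const_mul, integral_finsetSum _ fun k _ => (bk k).integrable _]
    congr 1
    refine Finset.sum_congr rfl fun k _ => ?_
    exact measurePreserving_integral_comp (measurePreserving_eval μ k)
      (f := fun e => ‖act (B k e) v‖ ^ 2) (bddMeas_norm_act_sq hBm hBr k v).1
  rw [integral_finsetSum _ fun S _ => (bS S).integrable _] at h1
  have h2 := Finset.sum_le_sum fun S (_ : S ∈ (univ : Finset (Finset ι))) => hs S
  rw [h1, Finset.sum_const, Finset.card_univ (α := Finset ι), Fintype.card_finset,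
    Finset.card_univ, nsmul_eq_mul] at h2
  push_cast at h2
  have := le_of_mul_le_mul_left h2 (by positivity)
  linarith

/-- For each unit vector the sum of squares is a sign average of squared images, hence at most the
sign average of squared operator norms. That bound is uniform in the vector, so no contraction is
needed. -/
lemma integral_squareSup_le :
    ∫ x, squareSup B x ∂Measure.pi μ ≤ 4 * ∫ x, ‖∑ k, B k (x k)‖ ^ 2 ∂Measure.pi μ := by
  classical
  have hs := fun S : Finset ι => integral_norm_signed_sum_pow_le (μ := μ) hBm hBr hB0 two_ne_zero S
  have bS : ∀ S : Finset ι, BddMeas fun x : ι → E => ‖∑ k, cubeSign S k • B k (x k)‖ ^ 2 :=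
    fun S => (bddMeas_norm_sum (Y := fun k e => cubeSign S k • B k e)
      (fun k => (hBm k).fun_const_smul _)
      (fun k e => by rw [norm_smul, Real.norm_eq_abs, abs_cubeSign, one_mul]; exact hBr k e)).pow 2
  have hpt : ∀ x : ι → E, squareSup B x
      ≤ (2 ^ #(univ : Finset ι))⁻¹ * ∑ S : Finset ι, ‖∑ k, cubeSign S k • B k (x k)‖ ^ 2 := by
    intro x
    refine ciSup_le fun n => ?_
    rw [le_inv_mul_iff₀ (by positivity)]
    have := sum_norm_add_signed_sum_sq univ (fun k => act (B k (x k)) (unitSeq N n).1) 0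
    simp only [norm_zero, zero_add, ne_eq, OfNat.ofNat_ne_zero, not_false_eq_true, zero_pow,
      Finset.powerset_univ] at this
    rw [← this]
    refine Finset.sum_le_sum fun S _ => pow_le_pow_left₀ (norm_nonneg _) ?_ 2
    have e : ∑ k, cubeSign S k • act (B k (x k)) (unitSeq N n).1
        = act (∑ k, cubeSign S k • B k (x k)) (unitSeq N n).1 := by
      have h := map_sum (actCLM (unitSeq N n).1) (fun k => cubeSign S k • B k (x k)) univ
      refine Eq.trans ?_ h.symm
      refine Finset.sum_congr rfl fun k _ => ?_
      exact (((actCLM (unitSeq N n).1).restrictScalars ℝ).map_smul (cubeSign S k) (B k (x k))).symm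
    rw [e]
    refine (norm_act_le _ _).trans ?_
    exact (mul_le_mul_of_nonneg_left (norm_unitSeq_fst_le N n) (norm_nonneg _)).trans
      (mul_one _).le
  refine (integral_mono ((bddMeas_squareSup hBm hBr).integrable _)
    (((BddMeas.sum univ fun S _ => bS S).integrable _).const_mul _) hpt).trans ?_
  rw [integral_const_mul, integral_finsetSum _ fun S _ => (bS S).integrable _,
    inv_mul_le_iff₀ (by positivity)]
  refine (Finset.sum_le_sum fun S _ => hs S).trans (le_of_eq ?_)
  rw [Finset.sum_const, Finset.card_univ, Fintype.card_finset, Finset.card_univ, nsmul_eq_mul]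
  push_cast
  ring

/-- Here the squares are linearized by `integral_iSup_sum_sq_le`, and the supremum of the resulting
signed bilinear form is at most the operator norm of the signed sum. This keeps the weak variance
separate from the operator norm. -/
lemma integral_formSup_le (hr0 : 0 ≤ r) {s : ℝ}
    (hs : ∀ v : EuclideanSpace ℂ (Fin N), ‖v‖ ≤ 1 →
      ∫ x, ‖∑ k, act (B k (x k)) v‖ ^ 2 ∂Measure.pi μ ≤ s) :
    ∫ x, formSup B x ∂Measure.pi μ
      ≤ 4 * s + 8 * r * ∫ x, ‖∑ k, B k (x k)‖ ∂Measure.pi μ := by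
  classical
  have hS := fun S : Finset ι => integral_norm_signed_sum_pow_le (μ := μ) hBm hBr hB0 one_ne_zero S
  simp only [pow_one] at hS
  have h := integral_iSup_sum_sq_le (μ := μ) (w := fun n k e =>
    (inner ℂ (unitSeq N n).1 (act (B k e) (unitSeq N n).2)).re)
    (fun n k => measurable_re_inner_act hBm k _ _) (r := r)
    (fun n k e => (abs_re_inner_act_le _ (norm_unitSeq_fst_le N n) _).trans
      (norm_act_unit_le hBr k _ (norm_unitSeq_snd_le N n))) (s := 4 * s) (fun n => ?_)
    (b := 2 * ∫ x, ‖∑ k, B k (x k)‖ ∂Measure.pi μ) (fun S => ?_) hr0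
  · refine h.trans (le_of_eq ?_); ring
  · refine le_trans ?_ ((sum_integral_norm_act_sq_le hBm hBr hB0 (unitSeq N n).2).trans
      (mul_le_mul_of_nonneg_left (hs _ (norm_unitSeq_snd_le N n)) (by norm_num)))
    refine Finset.sum_le_sum fun k _ => ?_
    have b2 := bddMeas_norm_act_sq hBm hBr k (unitSeq N n).2
    have b1 : BddMeas fun e => (inner ℂ (unitSeq N n).1 (act (B k e) (unitSeq N n).2)).re ^ 2 :=
      BddMeas.pow ⟨measurable_re_inner_act hBm k _ _, r, fun e =>
        (abs_re_inner_act_le _ (norm_unitSeq_fst_le N n) _).trans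
          (norm_act_unit_le hBr k _ (norm_unitSeq_snd_le N n))⟩ 2
    refine integral_mono (b1.integrable _) (b2.integrable _) fun e => ?_
    simp only
    rw [← sq_abs]
    exact pow_le_pow_left₀ (abs_nonneg _) (abs_re_inner_act_le _ (norm_unitSeq_fst_le N n) _) 2
  · refine le_trans ?_ (hS S)
    have bS : BddMeas fun x : ι → E => ‖∑ k, cubeSign S k • B k (x k)‖ :=
      bddMeas_norm_sum (Y := fun k e => cubeSign S k • B k e)
      (fun k => (hBm k).fun_const_smul _)
      (fun k e => by rw [norm_smul, Real.norm_eq_abs, abs_cubeSign, one_mul]; exact hBr k e)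
    have bL : BddMeas fun x : ι → E => ⨆ n, ∑ k, cubeSign S k *
        (inner ℂ (unitSeq N n).1 (act (B k (x k)) (unitSeq N n).2)).re :=
      BddMeas.iSup_sum (w := fun n k e => cubeSign S k *
        (inner ℂ (unitSeq N n).1 (act (B k e) (unitSeq N n).2)).re)
        (fun n k => (measurable_re_inner_act hBm k _ _).const_mul _) (C := r) fun n k e => by
          rw [abs_mul, abs_cubeSign, one_mul]
          exact (abs_re_inner_act_le _ (norm_unitSeq_fst_le N n) _).trans
            (norm_act_unit_le hBr k _ (norm_unitSeq_snd_le N n))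
    refine integral_mono (bL.integrable _) (bS.integrable _) fun x => ?_
    refine ciSup_le fun n => ?_
    have e : ∑ k, cubeSign S k * (inner ℂ (unitSeq N n).1 (act (B k (x k)) (unitSeq N n).2)).re
        = (inner ℂ (unitSeq N n).1
          (act (∑ k, cubeSign S k • B k (x k)) (unitSeq N n).2)).re := by
      have h := map_sum (actCLM (unitSeq N n).2) (fun k => cubeSign S k • B k (x k)) univ
      change act (∑ k, cubeSign S k • B k (x k)) (unitSeq N n).2 = _ at h
      rw [h, inner_sum, Complex.re_sum]
      refine Finset.sum_congr rfl fun k _ => ?_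
      have h2 : actCLM (unitSeq N n).2 (cubeSign S k • B k (x k))
          = (cubeSign S k : ℂ) • act (B k (x k)) (unitSeq N n).2 := by
        refine Eq.trans ?_ ((actCLM (unitSeq N n).2).map_smul (cubeSign S k : ℂ) (B k (x k)))
        congr 1
      rw [h2, inner_smul_right, Complex.re_ofReal_mul]
    rw [e]
    refine (le_abs_self _).trans ((abs_re_inner_act_le _ (norm_unitSeq_fst_le N n) _).trans ?_)
    refine (norm_act_le _ _).trans ?_
    exact (mul_le_mul_of_nonneg_left (norm_unitSeq_snd_le N n) (norm_nonneg _)).trans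
      (mul_one _).le

end CoreMoments

/-! ### Moments of the resolvent entry at the scale of the threshold. -/

section ResolventMoments

variable {N : ℕ} {ι : Type*} [Fintype ι] {E : Type*} [MeasurableSpace E]
  {μ : ι → Measure E} [∀ k, IsProbabilityMeasure (μ k)]

lemma stronglyMeasurable_add_sum {B : ι → E → Matrix (Fin N) (Fin N) ℂ}
    (hBm : ∀ k, StronglyMeasurable (B k)) (Z₀ : Matrix (Fin N) (Fin N) ℂ) :
    StronglyMeasurable fun x : ι → E => Z₀ + ∑ k, B k (x k) :=
  stronglyMeasurable_const.add (Finset.stronglyMeasurable_fun_sum _ fun k _ =>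
    (hBm k).comp_measurable (measurable_pi_apply k))

lemma bddMeas_resolvRe {Z₀ : Matrix (Fin N) (Fin N) ℂ} (h₀ : Z₀.IsHermitian)
    {B : ι → E → Matrix (Fin N) (Fin N) ℂ} (hBm : ∀ k, StronglyMeasurable (B k))
    (hBh : ∀ k e, (B k e).IsHermitian) {z : ℂ} (hz : 0 < z.im)
    (u v : EuclideanSpace ℂ (Fin N)) : BddMeas (resolvRe u v z Z₀ B) := by
  refine ⟨?_, ‖u‖ * (z.im⁻¹ * ‖v‖), fun x => ?_⟩
  · have h1 := stronglyMeasurable_resolv (stronglyMeasurable_add_sum hBm Z₀) z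
    have h2 := (continuous_act_apply v).comp_stronglyMeasurable h1
    have h3 : Continuous fun w : EuclideanSpace ℂ (Fin N) => (inner ℂ u w).re := by fun_prop
    exact (h3.comp_stronglyMeasurable h2).measurable
  · refine (Complex.abs_re_le_norm _).trans ((norm_inner_le_norm _ _).trans ?_)
    refine mul_le_mul_of_nonneg_left ((norm_act_le _ _).trans ?_) (norm_nonneg _)
    exact mul_le_mul_of_nonneg_right (norm_resolv_le hz (isHermitian_add_sum h₀ hBh x))
      (norm_nonneg _)

lemma add_add_pow_le {a b c d : ℝ} (ha : 0 ≤ a) (hb : 0 ≤ b) (hc : 0 ≤ c) (hd : 0 ≤ d) (n : ℕ) :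
    (a + b + (c + d)) ^ (n + 1) ≤ 4 ^ n * (a ^ (n + 1) + b ^ (n + 1) + c ^ (n + 1) + d ^ (n + 1)) := by
  have h1 := add_pow_le (add_nonneg ha hb) (add_nonneg hc hd) (n + 1)
  have h2 := add_pow_le ha hb (n + 1)
  have h3 := add_pow_le hc hd (n + 1)
  rw [Nat.add_sub_cancel] at h1 h2 h3
  have h4 : (4 : ℝ) ^ n = 2 ^ n * 2 ^ n := by rw [← mul_pow]; norm_num
  calc _ ≤ _ := h1
    _ ≤ 2 ^ n * (2 ^ n * (a ^ (n + 1) + b ^ (n + 1)) + 2 ^ n * (c ^ (n + 1) + d ^ (n + 1))) := by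
      gcongr
    _ = _ := by rw [h4]; ring

/-- The scale of the fluctuations of resolvent entries. -/
noncomputable def deviation (σ r m₁ m₂ η x : ℝ) : ℝ :=
  σ / η ^ 2 * √x + (r / η ^ 2 + r ^ 2 / η ^ 3) * x + (√r * √m₁ / η ^ 2 + r * √m₂ / η ^ 3) * √x

/-- The left side is a combination of the squares of the five nonnegative terms of `deviation`, with
largest coefficient `512`, and the sum of these squares is at most the square of their sum. -/
lemma moment_scale_le {σ r m₁ m₂ η q : ℝ} (hσ : 0 ≤ σ) (hr : 0 ≤ r) (h₁ : 0 ≤ m₁) (h₂ : 0 ≤ m₂)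
    (hη : 0 < η) (hq : 0 ≤ q) :
    8 * q * (4 * η⁻¹ ^ 4 * (4 * σ ^ 2 + 8 * r * m₁ + q * r ^ 2)
      + 16 * r ^ 2 * η⁻¹ ^ 6 * (4 * m₂ + q * r ^ 2)) ≤ 512 * deviation σ r m₁ m₂ η q ^ 2 := by
  set a₁ := σ / η ^ 2 * √q
  set a₂ := r / η ^ 2 * q
  set a₃ := r ^ 2 / η ^ 3 * q
  set a₄ := √r * √m₁ / η ^ 2 * √q
  set a₅ := r * √m₂ / η ^ 3 * √q
  have e : deviation σ r m₁ m₂ η q = a₁ + a₂ + a₃ + a₄ + a₅ := by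
    simp only [deviation, a₁, a₂, a₃, a₄, a₅]; ring
  have p₁ : 0 ≤ a₁ := by positivity
  have p₂ : 0 ≤ a₂ := by positivity
  have p₃ : 0 ≤ a₃ := by positivity
  have p₄ : 0 ≤ a₄ := by positivity
  have p₅ : 0 ≤ a₅ := by positivity
  have s₁ : a₁ ^ 2 = σ ^ 2 * q * η⁻¹ ^ 4 := by
    simp only [a₁, mul_pow, div_pow, Real.sq_sqrt hq]; field_simp
  have s₂ : a₂ ^ 2 = r ^ 2 * q ^ 2 * η⁻¹ ^ 4 := by
    simp only [a₂, mul_pow, div_pow]; field_simp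
  have s₃ : a₃ ^ 2 = r ^ 4 * q ^ 2 * η⁻¹ ^ 6 := by
    simp only [a₃, mul_pow, div_pow]; field_simp
  have s₄ : a₄ ^ 2 = r * m₁ * q * η⁻¹ ^ 4 := by
    simp only [a₄, mul_pow, div_pow, Real.sq_sqrt hq, Real.sq_sqrt hr, Real.sq_sqrt h₁]; field_simp
  have s₅ : a₅ ^ 2 = r ^ 2 * m₂ * q * η⁻¹ ^ 6 := by
    simp only [a₅, mul_pow, div_pow, Real.sq_sqrt hq, Real.sq_sqrt h₂]; field_simp
  have hl : 8 * q * (4 * η⁻¹ ^ 4 * (4 * σ ^ 2 + 8 * r * m₁ + q * r ^ 2)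
      + 16 * r ^ 2 * η⁻¹ ^ 6 * (4 * m₂ + q * r ^ 2))
      = 128 * a₁ ^ 2 + 32 * a₂ ^ 2 + 128 * a₃ ^ 2 + 256 * a₄ ^ 2 + 512 * a₅ ^ 2 := by
    rw [s₁, s₂, s₃, s₄, s₅]; ring
  have hsum : a₁ ^ 2 + a₂ ^ 2 + a₃ ^ 2 + a₄ ^ 2 + a₅ ^ 2 ≤ (a₁ + a₂ + a₃ + a₄ + a₅) ^ 2 := by
    have : 0 ≤ a₁ * a₂ + a₁ * a₃ + a₁ * a₄ + a₁ * a₅ + a₂ * a₃ + a₂ * a₄ + a₂ * a₅ + a₃ * a₄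
      + a₃ * a₅ + a₄ * a₅ := by positivity
    linarith
  rw [hl, e]
  linarith [sq_nonneg a₁, sq_nonneg a₂, sq_nonneg a₃, sq_nonneg a₄, sq_nonneg a₅]

/-- Moments of the fluctuations of resolvent entries. -/
theorem integral_resolvRe_pow_le {Z₀ : Matrix (Fin N) (Fin N) ℂ} (h₀ : Z₀.IsHermitian)
    {B : ι → E → Matrix (Fin N) (Fin N) ℂ} (hBm : ∀ k, StronglyMeasurable (B k))
    (hBh : ∀ k e, (B k e).IsHermitian) {r : ℝ} (hr0 : 0 ≤ r) (hBr : ∀ k e, ‖B k e‖ ≤ r)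
    (hB0 : ∀ k, ∫ e, B k e ∂μ k = 0) {z : ℂ} (hz : 0 < z.im)
    {u v : EuclideanSpace ℂ (Fin N)} (hu : ‖u‖ = 1) (hv : ‖v‖ = 1) {σ : ℝ} (hσ : 0 ≤ σ)
    (hs : ∀ v : EuclideanSpace ℂ (Fin N), ‖v‖ ≤ 1 →
      ∫ x, ‖∑ k, act (B k (x k)) v‖ ^ 2 ∂Measure.pi μ ≤ σ ^ 2) (n : ℕ) :
    ∫ x, (resolvRe u v z Z₀ B x - ∫ y, resolvRe u v z Z₀ B y ∂Measure.pi μ) ^ (2 * (n + 1))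
        ∂Measure.pi μ
      ≤ (512 * deviation σ r (∫ x, ‖∑ k, B k (x k)‖ ∂Measure.pi μ)
          (∫ x, ‖∑ k, B k (x k)‖ ^ 2 ∂Measure.pi μ) z.im (n + 1) ^ 2) ^ (n + 1) := by
  classical
  set m₁ := ∫ x, ‖∑ k, B k (x k)‖ ∂Measure.pi μ
  set m₂ := ∫ x, ‖∑ k, B k (x k)‖ ^ 2 ∂Measure.pi μ
  have hm₁ : 0 ≤ m₁ := integral_nonneg fun x => norm_nonneg _
  have hm₂ : 0 ≤ m₂ := integral_nonneg fun x => sq_nonneg _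
  have hbF := bddMeas_resolvRe h₀ hBm hBh hz u v
  have bW := bddMeas_formSup hBm hBr
  have bQ := bddMeas_squareSup hBm hBr
  have hW0 : ∀ x, 0 ≤ formSup B x := fun x =>
    Real.iSup_nonneg fun n => Finset.sum_nonneg fun k _ => sq_nonneg _
  have hQ0 : ∀ x, 0 ≤ squareSup B x := fun x =>
    Real.iSup_nonneg fun n => Finset.sum_nonneg fun k _ => sq_nonneg _
  set α := 4 * z.im⁻¹ ^ 4
  set β := 16 * r ^ 2 * z.im⁻¹ ^ 6
  have hα : 0 ≤ α := by positivity
  have hβ : 0 ≤ β := by positivity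
  set c₁ := 4 * σ ^ 2 + 8 * r * m₁ + (n + 1) * r ^ 2
  set c₂ := 4 * m₂ + (n + 1) * r ^ 2
  have hc₁ : 0 ≤ c₁ := by positivity
  have hc₂ : 0 ≤ c₂ := by positivity
  have hW : ∫ x, formSup B x ^ (n + 1) ∂Measure.pi μ ≤ c₁ ^ (n + 1) := by
    refine (integral_formSup_pow_le hBm hBr (n + 1)).trans ?_
    refine pow_le_pow_left₀ (add_nonneg (integral_nonneg hW0) (by positivity)) ?_ _
    have := integral_formSup_le hBm hBr hB0 hr0 hs
    push_cast
    linarith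
  have hQ : ∫ x, squareSup B x ^ (n + 1) ∂Measure.pi μ ≤ c₂ ^ (n + 1) := by
    refine (integral_squareSup_pow_le hBm hBr (n + 1)).trans ?_
    refine pow_le_pow_left₀ (add_nonneg (integral_nonneg hQ0) (by positivity)) ?_ _
    have := integral_squareSup_le hBm hBr hB0
    push_cast
    linarith
  have hV : ∫ θ, efronStein (resolvRe u v z Z₀ B) θ ^ (n + 1) ∂pairMeasure μ
      ≤ (4 * (α * c₁ + β * c₂)) ^ (n + 1) := by
    have hpt : ∀ θ : ι → E × E, efronStein (resolvRe u v z Z₀ B) θ ^ (n + 1)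
        ≤ 4 ^ n * (α ^ (n + 1) * formSup B (firstCopy θ) ^ (n + 1)
          + α ^ (n + 1) * formSup B (secondCopy θ) ^ (n + 1)
          + β ^ (n + 1) * squareSup B (firstCopy θ) ^ (n + 1)
          + β ^ (n + 1) * squareSup B (secondCopy θ) ^ (n + 1)) := by
      intro θ
      refine (pow_le_pow_left₀ (efronStein_nonneg _ _)
        (efronStein_resolvRe_le h₀ hBh hBr hz hu hv θ) _).trans ?_
      rw [mul_add, mul_add]
      refine (add_add_pow_le (mul_nonneg hα (hW0 _)) (mul_nonneg hα (hW0 _))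
        (mul_nonneg hβ (hQ0 _)) (mul_nonneg hβ (hQ0 _)) n).trans (le_of_eq ?_)
      simp only [mul_pow]
    have b1 : BddMeas fun θ : ι → E × E => α ^ (n + 1) * formSup B (firstCopy θ) ^ (n + 1) :=
      (BddMeas.const _).mul ((bW.comp measurable_firstCopy).pow _)
    have b2 : BddMeas fun θ : ι → E × E => α ^ (n + 1) * formSup B (secondCopy θ) ^ (n + 1) :=
      (BddMeas.const _).mul (bW.secondCopy.pow _)
    have b3 : BddMeas fun θ : ι → E × E => β ^ (n + 1) * squareSup B (firstCopy θ) ^ (n + 1) :=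
      (BddMeas.const _).mul ((bQ.comp measurable_firstCopy).pow _)
    have b4 : BddMeas fun θ : ι → E × E => β ^ (n + 1) * squareSup B (secondCopy θ) ^ (n + 1) :=
      (BddMeas.const _).mul (bQ.secondCopy.pow _)
    refine (integral_mono ((hbF.efronStein.pow _).integrable _)
      (((((b1.add b2).add b3).add b4).integrable _).const_mul _) hpt).trans ?_
    rw [integral_const_mul, integral_add (((b1.add b2).add b3).integrable _) (b4.integrable _),
      integral_add ((b1.add b2).integrable _) (b3.integrable _),
      integral_add (b1.integrable _) (b2.integrable _), integral_const_mul,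
      integral_const_mul, integral_const_mul, integral_const_mul,
      measurePreserving_integral_comp (measurePreserving_firstCopy μ)
        (f := fun x => formSup B x ^ (n + 1)) (bW.pow _).1,
      measurePreserving_integral_comp (measurePreserving_firstCopy μ)
        (f := fun x => squareSup B x ^ (n + 1)) (bQ.pow _).1,
      integral_secondCopy (f := fun x => formSup B x ^ (n + 1)) (bW.pow _).1,
      integral_secondCopy (f := fun x => squareSup B x ^ (n + 1)) (bQ.pow _).1]
    have t1 : α ^ (n + 1) * ∫ x, formSup B x ^ (n + 1) ∂Measure.pi μ
        ≤ (α * c₁ + β * c₂) ^ (n + 1) := by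
      refine (mul_le_mul_of_nonneg_left hW (by positivity)).trans ?_
      rw [← mul_pow]
      exact pow_le_pow_left₀ (by positivity) (le_add_of_nonneg_right (by positivity)) _
    have t2 : β ^ (n + 1) * ∫ x, squareSup B x ^ (n + 1) ∂Measure.pi μ
        ≤ (α * c₁ + β * c₂) ^ (n + 1) := by
      refine (mul_le_mul_of_nonneg_left hQ (by positivity)).trans ?_
      rw [← mul_pow]
      exact pow_le_pow_left₀ (by positivity) (le_add_of_nonneg_left (by positivity)) _
    have e : (4 * (α * c₁ + β * c₂)) ^ (n + 1) = 4 ^ n * (4 * (α * c₁ + β * c₂) ^ (n + 1)) := by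
      rw [mul_pow]; ring
    rw [e]
    exact mul_le_mul_of_nonneg_left (by linarith) (by positivity : (0 : ℝ) ≤ 4 ^ n)
  refine (integral_pow_le_efronStein hbF n).trans ?_
  -- The factor `8` is `2` from `2n + 1 ≤ 2 (n + 1)` times `4` from splitting `V` into four suprema.
  calc (2 * n + 1 : ℝ) ^ (n + 1) * ∫ θ, efronStein (resolvRe u v z Z₀ B) θ ^ (n + 1) ∂pairMeasure μ
      ≤ (2 * (n + 1)) ^ (n + 1) * (4 * (α * c₁ + β * c₂)) ^ (n + 1) := by
        refine mul_le_mul (pow_le_pow_left₀ (by positivity) (by linarith) _) hV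
          (integral_nonneg fun θ => pow_nonneg (efronStein_nonneg _ _) _) (by positivity)
    _ = (8 * (n + 1) * (α * c₁ + β * c₂)) ^ (n + 1) := by rw [← mul_pow]; ring
    _ ≤ _ := by
        refine pow_le_pow_left₀ (mul_nonneg (by positivity) (by positivity)) ?_ _
        exact moment_scale_le hσ hr0 hm₁ hm₂ hz (by positivity)

end ResolventMoments

/-! ### From moments to tails -/

section Tail

lemma deviation_nonneg {σ r m₁ m₂ η x : ℝ} (hσ : 0 ≤ σ) (hr : 0 ≤ r) (hη : 0 < η) (hx : 0 ≤ x) :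
    0 ≤ deviation σ r m₁ m₂ η x := by
  unfold deviation; positivity

lemma deviation_pos {σ r m₁ m₂ η x : ℝ} (hσ : 0 ≤ σ) (hr : 0 < r) (hη : 0 < η) (hx : 0 < x) :
    0 < deviation σ r m₁ m₂ η x := by
  unfold deviation; positivity

/-- The slowest growth among the terms is that of `√x`, and `4096 = 64 ^ 2`. -/
lemma mul_deviation_le {σ r m₁ m₂ η x y : ℝ} (hσ : 0 ≤ σ) (hr : 0 ≤ r) (hη : 0 < η) (hy : 0 ≤ y)
    (hxy : 4096 * y ≤ x) : 64 * deviation σ r m₁ m₂ η y ≤ deviation σ r m₁ m₂ η x := by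
  have h1 : 64 * √y ≤ √x := by
    refine Real.le_sqrt_of_sq_le ?_
    rw [mul_pow, Real.sq_sqrt hy]; linarith
  have h2 : 64 * y ≤ x := by linarith
  unfold deviation
  have t1 := mul_le_mul_of_nonneg_left h1 (by positivity : 0 ≤ σ / η ^ 2)
  have t2 := mul_le_mul_of_nonneg_left h2 (by positivity : 0 ≤ r / η ^ 2 + r ^ 2 / η ^ 3)
  have t3 := mul_le_mul_of_nonneg_left h1
    (by positivity : 0 ≤ √r * √m₁ / η ^ 2 + r * √m₂ / η ^ 3)
  linarith

variable {Ω : Type*} [MeasurableSpace Ω] {P : Measure Ω} [IsProbabilityMeasure P]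

lemma measureReal_sq_ge_le {g : Ω → ℝ} (hg : BddMeas g) {σ r m₁ m₂ η : ℝ} (hσ : 0 ≤ σ)
    (hr : 0 < r) (hη : 0 < η)
    (hmom : ∀ n : ℕ, ∫ ω, g ω ^ (2 * (n + 1)) ∂P
      ≤ (512 * deviation σ r m₁ m₂ η (n + 1) ^ 2) ^ (n + 1)) {x : ℝ} (hx : 4096 ≤ x) :
    P.real {ω | deviation σ r m₁ m₂ η x ^ 2 / 2 ≤ g ω ^ 2} ≤ Real.exp (-(1 / 8192) * x) := by
  set τ := deviation σ r m₁ m₂ η x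
  have hτ : 0 < τ := deviation_pos hσ hr hη (by linarith)
  -- The moment order is proportional to `x`, so that `512 * deviation ^ 2` at that order is at most
  -- `512 τ² / 4096 = τ² / 8`, a quarter of the level `τ² / 2`. Markov then gives `(1/4) ^ (n + 1)`.
  obtain ⟨n, hn⟩ : ∃ n : ℕ, ⌊x / 4096⌋₊ = n + 1 :=
    Nat.exists_eq_succ_of_ne_zero (Nat.pos_iff_ne_zero.1
      (Nat.floor_pos.2 (by rw [le_div_iff₀ (by norm_num)]; linarith)))
  have hnx : ((n : ℝ) + 1) ≤ x / 4096 := by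
    have := Nat.floor_le (by positivity : 0 ≤ x / 4096)
    rw [hn] at this; exact_mod_cast this
  have hnx' : x / 4096 < (n : ℝ) + 1 + 1 := by
    have := Nat.lt_floor_add_one (x / 4096)
    rw [hn] at this; exact_mod_cast this
  have h64 : 64 * deviation σ r m₁ m₂ η (n + 1) ≤ τ :=
    mul_deviation_le hσ hr.le hη (by positivity) (by linarith)
  have hdn := deviation_nonneg (m₁ := m₁) (m₂ := m₂) hσ hr.le hη (by positivity : (0 : ℝ) ≤ n + 1)
  have hsub : {ω | τ ^ 2 / 2 ≤ g ω ^ 2} ⊆ {ω | (τ ^ 2 / 2) ^ (n + 1) ≤ g ω ^ (2 * (n + 1))} := by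
    intro ω hω
    simp only [Set.mem_ofPred_eq] at hω ⊢
    rw [pow_mul]
    exact pow_le_pow_left₀ (by positivity) hω _
  have hM := mul_meas_ge_le_integral_of_nonneg (μ := P) (f := fun ω => g ω ^ (2 * (n + 1)))
    (ae_of_all _ fun ω => (even_two_mul (n + 1)).pow_nonneg _) ((hg.pow _).integrable _)
    ((τ ^ 2 / 2) ^ (n + 1))
  have h1 : P.real {ω | τ ^ 2 / 2 ≤ g ω ^ 2}
      ≤ P.real {ω | (τ ^ 2 / 2) ^ (n + 1) ≤ g ω ^ (2 * (n + 1))} := measureReal_mono hsub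
  have h2 : 512 * deviation σ r m₁ m₂ η (n + 1) ^ 2 ≤ 1 / 4 * (τ ^ 2 / 2) := by
    have := pow_le_pow_left₀ (by positivity) h64 2
    rw [mul_pow] at this
    linarith
  have h3 : (τ ^ 2 / 2) ^ (n + 1) * P.real {ω | (τ ^ 2 / 2) ^ (n + 1) ≤ g ω ^ (2 * (n + 1))}
      ≤ (τ ^ 2 / 2) ^ (n + 1) * (1 / 4) ^ (n + 1) := by
    refine hM.trans ((hmom n).trans ?_)
    rw [← mul_pow, mul_comm (τ ^ 2 / 2)]
    exact pow_le_pow_left₀ (by positivity) h2 _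
  have h4 := le_of_mul_le_mul_left h3 (by positivity)
  refine h1.trans (h4.trans ?_)
  have h5 : (1 / 4 : ℝ) ≤ Real.exp (-1) := by
    rw [Real.exp_neg, one_div]
    exact inv_anti₀ (Real.exp_pos 1) (Real.exp_one_lt_d9.le.trans (by norm_num))
  calc (1 / 4 : ℝ) ^ (n + 1) ≤ Real.exp (-1) ^ (n + 1) := pow_le_pow_left₀ (by norm_num) h5 _
    _ = Real.exp (-((n : ℝ) + 1)) := by
      rw [← Real.exp_nat_mul]; push_cast; ring_nf
    _ ≤ _ := by
      -- Rounding down costs at most a factor two: `x / 4096 < n + 2 ≤ 2 (n + 1)`, whence `8192`.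
      rw [Real.exp_le_exp]
      have : (0 : ℝ) ≤ n := Nat.cast_nonneg n
      linarith

end Tail

/-! ### Matrices as a measurable space -/

section Measurability

variable {N : ℕ}

instance matrixBorelSpace : BorelSpace (Matrix (Fin N) (Fin N) ℂ) :=
  inferInstanceAs (BorelSpace (Fin N → Fin N → ℂ))

instance matrixSecondCountable : SecondCountableTopology (Matrix (Fin N) (Fin N) ℂ) :=
  inferInstanceAs (SecondCountableTopology (Fin N → Fin N → ℂ))

/-- Evaluation of a matrix entry. -/
noncomputable def entryCLM (i j : Fin N) : Matrix (Fin N) (Fin N) ℂ →L[ℂ] ℂ where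
  toFun A := A i j
  map_add' _ _ := rfl
  map_smul' _ _ := rfl
  cont := by fun_prop

variable {Ω : Type*} [MeasurableSpace Ω] {P : Measure Ω}

lemma expect_eq_integral {F : Ω → Matrix (Fin N) (Fin N) ℂ} (hF : Integrable F P) :
    expect P F = ∫ ω, F ω ∂P := by
  ext i j
  exact (entryCLM i j).integral_comp_comm hF

lemma expect_congr_ae {F G : Ω → Matrix (Fin N) (Fin N) ℂ} (h : F =ᵐ[P] G) :
    expect P F = expect P G := by
  ext i j
  exact integral_congr_ae (h.mono fun ω hω => by simp only; rw [hω])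

open Classical in
/-- Replace a matrix by zero unless it is Hermitian with norm at most `r`. -/
noncomputable def clip (r : ℝ) (A : Matrix (Fin N) (Fin N) ℂ) : Matrix (Fin N) (Fin N) ℂ :=
  if A.IsHermitian ∧ ‖A‖ ≤ r then A else 0

lemma clip_isHermitian (r : ℝ) (A : Matrix (Fin N) (Fin N) ℂ) : (clip r A).IsHermitian := by
  unfold clip
  split_ifs with h
  · exact h.1
  · exact Matrix.isHermitian_zero

lemma norm_clip_le {r : ℝ} (hr : 0 ≤ r) (A : Matrix (Fin N) (Fin N) ℂ) : ‖clip r A‖ ≤ r := by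
  unfold clip
  split_ifs with h
  · exact h.2
  · simpa using hr

lemma stronglyMeasurable_clip (r : ℝ) :
    StronglyMeasurable (clip r : Matrix (Fin N) (Fin N) ℂ → Matrix (Fin N) (Fin N) ℂ) := by
  classical
  refine Measurable.stronglyMeasurable (Measurable.ite ?_ measurable_id measurable_const)
  have h1 : IsClosed {A : Matrix (Fin N) (Fin N) ℂ | A.IsHermitian} :=
    isClosed_eq (by fun_prop : Continuous fun A : Matrix (Fin N) (Fin N) ℂ => A.conjTranspose)
      continuous_id
  have h2 : IsClosed {A : Matrix (Fin N) (Fin N) ℂ | ‖A‖ ≤ r} :=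
    isClosed_le continuous_norm continuous_const
  exact (h1.inter h2).measurableSet

end Measurability

/-! ### Real vectors and the deviation threshold -/

section Threshold

variable {N : ℕ}

/-- A real vector as a complex vector. -/
noncomputable def complexify (u : EuclideanSpace ℝ (Fin N)) : EuclideanSpace ℂ (Fin N) :=
  WithLp.toLp 2 fun i => (u i : ℂ)

lemma norm_complexify (u : EuclideanSpace ℝ (Fin N)) : ‖complexify u‖ = ‖u‖ := by
  simp [EuclideanSpace.norm_eq, complexify]

lemma resolventEntry_eq (u v : EuclideanSpace ℝ (Fin N)) (z : ℂ) (A : Matrix (Fin N) (Fin N) ℂ) :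
    resolventEntry u v z A = inner ℂ (complexify u) (act (resolv z A) (complexify v)) := by
  simp only [resolventEntry, PiLp.inner_apply, act, Matrix.ofLp_toEuclideanCLM, complexify,
    RCLike.inner_apply, Complex.conj_ofReal, Matrix.mulVec, dotProduct, Finset.sum_mul, resolv]
  refine Finset.sum_congr rfl fun i _ => Finset.sum_congr rfl fun j _ => ?_
  ring

variable {Ω : Type*} [MeasurableSpace Ω] {P : Measure Ω} {n : ℕ}

lemma threshold_eq_ofReal {Z₀ : Matrix (Fin N) (Fin N) ℂ}
    {Z : Fin n → Ω → Matrix (Fin N) (Fin N) ℂ} {r m₁ m₂ η x : ℝ} (hr : 0 ≤ r) (h₁ : 0 ≤ m₁)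
    (h₂ : 0 ≤ m₂) (hη : 0 < η) (hx : 0 ≤ x) (hR : R P Z = ENNReal.ofReal r)
    (hm₁ : normMoment P (model Z₀ Z) 1 = ENNReal.ofReal m₁)
    (hm₂ : normMoment P (model Z₀ Z) 2 = ENNReal.ofReal m₂) :
    threshold P Z₀ Z η x
      = ENNReal.ofReal (deviation (sigma P (model Z₀ Z)) r m₁ m₂ η x) := by
  have hσ : 0 ≤ sigma P (model Z₀ Z) := Real.sqrt_nonneg _
  have half : ∀ {y : ℝ}, 0 ≤ y → ENNReal.ofReal y ^ (1 / 2 : ℝ) = ENNReal.ofReal √y := fun hy => by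
    rw [ENNReal.ofReal_rpow_of_nonneg hy (by norm_num), Real.sqrt_eq_rpow]
  unfold threshold deviation
  rw [hR, hm₁, hm₂, half hr, half h₁, half h₂, ← ENNReal.ofReal_pow hr,
    ← ENNReal.ofReal_mul (Real.sqrt_nonneg _), ← ENNReal.ofReal_mul hr,
    ← ENNReal.ofReal_div_of_pos (by positivity), ← ENNReal.ofReal_div_of_pos (by positivity),
    ← ENNReal.ofReal_div_of_pos (by positivity), ← ENNReal.ofReal_div_of_pos (by positivity),
    ← ENNReal.ofReal_add (by positivity) (by positivity),
    ← ENNReal.ofReal_add (by positivity) (by positivity),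
    ← ENNReal.ofReal_mul (by positivity), ← ENNReal.ofReal_mul (by positivity),
    ← ENNReal.ofReal_add (by positivity) (by positivity),
    ← ENNReal.ofReal_add (by positivity) (by positivity)]

lemma threshold_eq_top {Z₀ : Matrix (Fin N) (Fin N) ℂ}
    {Z : Fin n → Ω → Matrix (Fin N) (Fin N) ℂ} {η x : ℝ} (hx : 0 < x) (hR : R P Z = ∞) :
    threshold P Z₀ Z η x = ∞ := by
  unfold threshold
  rw [hR, ENNReal.top_div_of_ne_top ENNReal.ofReal_ne_top, top_add,
    ENNReal.top_mul (by simpa using hx)]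
  simp

end Threshold

/-! ### Transfer to independent random matrices -/

section Transfer

variable {N n : ℕ} {Ω : Type*} [MeasurableSpace Ω] {P : Measure Ω} [IsProbabilityMeasure P]
  {Z₀ : Matrix (Fin N) (Fin N) ℂ} {Z : Fin n → Ω → Matrix (Fin N) (Fin N) ℂ}

-- Clipping turns the almost sure hypotheses into ones valid for every matrix, as the product-space
-- estimates require, and changes the `Z k` only on a null set.
omit [IsProbabilityMeasure P] in
lemma ae_clip_eq (hZh : ∀ k, ∀ᵐ ω ∂P, (Z k ω).IsHermitian) {r : ℝ} (hr : 0 ≤ r)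
    (hR : R P Z = ENNReal.ofReal r) : ∀ᵐ ω ∂P, ∀ k, clip r (Z k ω) = Z k ω := by
  have h1 : ∀ᵐ ω ∂P, (⨆ k, ‖Z k ω‖ₑ) ≤ ENNReal.ofReal r := by
    rw [← hR]; exact ENNReal.ae_le_essSup _
  filter_upwards [h1, ae_all_iff.2 hZh] with ω hω hω' k
  have h2 : ‖Z k ω‖ₑ ≤ ENNReal.ofReal r := (le_iSup (fun k => ‖Z k ω‖ₑ) k).trans hω
  rw [← ofReal_norm, ENNReal.ofReal_le_ofReal_iff hr] at h2
  exact if_pos ⟨hω' k, h2⟩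

lemma centered_model (hZi : ∀ k i j, Integrable (fun ω => Z k ω i j) P)
    (hZ0 : ∀ k, expect P (Z k) = 0) (ω : Ω) :
    centered P (model Z₀ Z) ω = ∑ k, Z k ω := by
  have h : expect P (model Z₀ Z) = Z₀ := by
    ext i j
    have h0 : ∀ k, ∫ ω, Z k ω i j ∂P = 0 := fun k => congrFun (congrFun (hZ0 k) i) j
    simp only [expect, model, Matrix.of_apply, Matrix.add_apply, Matrix.sum_apply]
    rw [integral_add (integrable_const _) (integrable_finsetSum _ fun k _ => hZi k i j),
      integral_finsetSum _ fun k _ => hZi k i j]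
    simp [h0]
  rw [centered, h, model, add_sub_cancel_left]

lemma integral_clip_eq_zero (hZm : ∀ k, Measurable (Z k)) (hZ0 : ∀ k, expect P (Z k) = 0)
    {r : ℝ} (hr : 0 ≤ r) (hae : ∀ᵐ ω ∂P, ∀ k, clip r (Z k ω) = Z k ω) (k : Fin n) :
    ∫ A, clip r A ∂P.map (Z k) = 0 := by
  have hm := stronglyMeasurable_clip (N := N) r
  rw [integral_map (hZm k).aemeasurable hm.aestronglyMeasurable]
  have hi : Integrable (fun ω => clip r (Z k ω)) P :=
    Integrable.of_bound (hm.comp_measurable (hZm k)).aestronglyMeasurable r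
      (ae_of_all _ fun ω => norm_clip_le hr _)
  rw [← expect_eq_integral hi, expect_congr_ae (hae.mono fun ω hω => hω k)]
  exact hZ0 k

lemma measurePreserving_vector (hZm : ∀ k, Measurable (Z k)) (hind : iIndepFun Z P) :
    MeasurePreserving (fun ω k => Z k ω) P (Measure.pi fun k => P.map (Z k)) :=
  ⟨measurable_pi_lambda _ hZm,
    (iIndepFun_iff_map_fun_eq_pi_map fun k => (hZm k).aemeasurable).1 hind⟩

lemma normMoment_eq_ofReal (hZm : ∀ k, Measurable (Z k)) (hind : iIndepFun Z P)
    (hZi : ∀ k i j, Integrable (fun ω => Z k ω i j) P) (hZ0 : ∀ k, expect P (Z k) = 0)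
    {r : ℝ} (hr : 0 ≤ r) (hae : ∀ᵐ ω ∂P, ∀ k, clip r (Z k ω) = Z k ω) (p : ℕ) :
    normMoment P (model Z₀ Z) p = ENNReal.ofReal
      (∫ x, ‖∑ k, clip r (x k)‖ ^ p ∂Measure.pi fun k => P.map (Z k)) := by
  have : ∀ k, IsProbabilityMeasure (P.map (Z k)) := fun k =>
    Measure.isProbabilityMeasure_map (hZm k).aemeasurable
  have hY := measurePreserving_vector hZm hind
  have hb := (bddMeas_norm_sum (fun _ : Fin n => stronglyMeasurable_clip (N := N) r)
    fun _ => norm_clip_le hr).pow p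
  rw [← measurePreserving_integral_comp hY hb.1, ofReal_integral_eq_lintegral_ofReal
    ((hb.comp hY.measurable).integrable _) (ae_of_all _ fun ω => by positivity)]
  refine lintegral_congr_ae (hae.mono fun ω hω => ?_)
  simp only [hω, centered_model hZi hZ0]
  rw [ENNReal.ofReal_pow (norm_nonneg _), ofReal_norm]

/-- With `C = X - EX` almost surely and `C` Hermitian, `E‖C v‖² = ⟨v, E[C²] v⟩ ≤ ‖E[C²]‖`, and both
norms in the definition of `sigma` equal this one. -/
lemma integral_norm_act_sq_le_sigma (hZm : ∀ k, Measurable (Z k)) (hind : iIndepFun Z P)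
    (hZi : ∀ k i j, Integrable (fun ω => Z k ω i j) P) (hZ0 : ∀ k, expect P (Z k) = 0)
    {r : ℝ} (hr : 0 ≤ r) (hae : ∀ᵐ ω ∂P, ∀ k, clip r (Z k ω) = Z k ω)
    (v : EuclideanSpace ℂ (Fin N)) (hv : ‖v‖ ≤ 1) :
    ∫ x, ‖∑ k, act (clip r (x k)) v‖ ^ 2 ∂Measure.pi (fun k => P.map (Z k))
      ≤ sigma P (model Z₀ Z) ^ 2 := by
  have : ∀ k, IsProbabilityMeasure (P.map (Z k)) := fun k =>
    Measure.isProbabilityMeasure_map (hZm k).aemeasurable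
  have hY := measurePreserving_vector hZm hind
  set C : Ω → Matrix (Fin N) (Fin N) ℂ := fun ω => ∑ k, clip r (Z k ω)
  have hCm : StronglyMeasurable C := Finset.stronglyMeasurable_fun_sum _ fun k _ =>
    (stronglyMeasurable_clip r).comp_measurable (hZm k)
  have hCh : ∀ ω, (C ω).conjTranspose = C ω := fun ω => by
    simp only [C, Matrix.conjTranspose_sum, (clip_isHermitian r _).eq]
  have hCb : ∀ ω, ‖C ω‖ ≤ n * r := fun ω =>
    (norm_sum_le _ _).trans ((Finset.sum_le_sum fun k _ => norm_clip_le hr _).trans (by simp))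
  have hCC : Integrable (fun ω => C ω * C ω) P :=
    Integrable.of_bound (hCm.mul hCm).aestronglyMeasurable ((n * r) * (n * r))
      (ae_of_all _ fun ω => (norm_mul_le _ _).trans
        (mul_le_mul (hCb ω) (hCb ω) (norm_nonneg _) (by positivity)))
  have e1 : expect P (fun ω => (centered P (model Z₀ Z) ω).conjTranspose
      * centered P (model Z₀ Z) ω) = ∫ ω, C ω * C ω ∂P := by
    rw [← expect_eq_integral hCC]
    refine expect_congr_ae (hae.mono fun ω hω => ?_)
    have : centered P (model Z₀ Z) ω = C ω := by
      rw [centered_model hZi hZ0]; simp only [C, hω]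
    simp only [this, hCh]
  have e2 : expect P (fun ω => centered P (model Z₀ Z) ω
      * (centered P (model Z₀ Z) ω).conjTranspose) = ∫ ω, C ω * C ω ∂P := by
    rw [← expect_eq_integral hCC]
    refine expect_congr_ae (hae.mono fun ω hω => ?_)
    have : centered P (model Z₀ Z) ω = C ω := by
      rw [centered_model hZi hZ0]; simp only [C, hω]
    simp only [this, hCh]
  rw [sigma, e1, e2, min_self, Real.sq_sqrt (norm_nonneg _)]
  have hb := (bddMeas_norm_sum (fun _ : Fin n => stronglyMeasurable_act
    (fun _ : Fin n => stronglyMeasurable_clip (N := N) r) ‹_› v) (r := r * ‖v‖)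
    fun _ A => (norm_act_le _ _).trans
      (mul_le_mul_of_nonneg_right (norm_clip_le hr A) (norm_nonneg _))).pow 2
  rw [← measurePreserving_integral_comp hY hb.1]
  have hpt : ∀ ω, ‖∑ k, act (clip r (Z k ω)) v‖ ^ 2
      = (inner ℂ v (actCLM v (C ω * C ω))).re := by
    intro ω
    have h1 : ∑ k, act (clip r (Z k ω)) v = act (C ω) v :=
      (map_sum (actCLM v) (fun k => clip r (Z k ω)) Finset.univ).symm
    change _ = (inner ℂ v (act (C ω * C ω) v)).re
    rw [h1, act_mul_apply, inner_act_right, hCh, inner_self_eq_norm_sq_to_K]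
    norm_cast
  simp only [hpt]
  have hL : ∫ ω, (inner ℂ v (actCLM v (C ω * C ω))).re ∂P
      = (inner ℂ v (actCLM v (∫ ω, C ω * C ω ∂P))).re := by
    have := (Complex.reCLM.comp (((innerSL ℂ v).comp (actCLM v)).restrictScalars ℝ)).integral_comp_comm
      hCC
    exact this
  rw [hL]
  refine (Complex.re_le_norm _).trans ((norm_inner_le_norm _ _).trans ?_)
  have h2 : ‖actCLM v (∫ ω, C ω * C ω ∂P)‖ ≤ ‖∫ ω, C ω * C ω ∂P‖ * 1 :=
    (norm_act_le _ _).trans (mul_le_mul_of_nonneg_left hv (norm_nonneg _))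
  calc ‖v‖ * ‖actCLM v (∫ ω, C ω * C ω ∂P)‖ ≤ 1 * (‖∫ ω, C ω * C ω ∂P‖ * 1) := by gcongr
    _ = _ := by ring

lemma measure_deviation_le (h₀ : Z₀.IsHermitian) (hZm : ∀ k, Measurable (Z k))
    (hZh : ∀ k, ∀ᵐ ω ∂P, (Z k ω).IsHermitian) (hind : iIndepFun Z P)
    (hZi : ∀ k i j, Integrable (fun ω => Z k ω i j) P) (hZ0 : ∀ k, expect P (Z k) = 0)
    {r : ℝ} (hr : 0 < r) (hR : R P Z = ENNReal.ofReal r) {z : ℂ} (hz : 0 < z.im)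
    {u v : EuclideanSpace ℝ (Fin N)} (hu : ‖u‖ = 1) (hv : ‖v‖ = 1) {x : ℝ} (hx : 4096 ≤ x) :
    P {ω | threshold P Z₀ Z z.im x ≤ ENNReal.ofReal
        ‖resolventEntry u v z (model Z₀ Z ω) - ∫ ω', resolventEntry u v z (model Z₀ Z ω') ∂P‖}
      ≤ ENNReal.ofReal (2 * Real.exp (-(1 / 8192) * x)) := by
  have hpr : ∀ k, IsProbabilityMeasure (P.map (Z k)) := fun k =>
    Measure.isProbabilityMeasure_map (hZm k).aemeasurable
  have hae := ae_clip_eq hZh hr.le hR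
  have hY := measurePreserving_vector hZm hind
  set π := Measure.pi fun k => P.map (Z k)
  set B : Fin n → Matrix (Fin N) (Fin N) ℂ → Matrix (Fin N) (Fin N) ℂ := fun _ => clip r
  have hBm : ∀ k, StronglyMeasurable (B k) := fun _ => stronglyMeasurable_clip r
  have hBh : ∀ k A, (B k A).IsHermitian := fun _ A => clip_isHermitian r A
  have hBr : ∀ k A, ‖B k A‖ ≤ r := fun _ A => norm_clip_le hr.le A
  have hB0 : ∀ k, ∫ A, B k A ∂P.map (Z k) = 0 := integral_clip_eq_zero hZm hZ0 hr.le hae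
  have hs := integral_norm_act_sq_le_sigma (Z₀ := Z₀) hZm hind hZi hZ0 hr.le hae
  set σ := sigma P (model Z₀ Z)
  have hσ : 0 ≤ σ := Real.sqrt_nonneg _
  set m₁ := ∫ y, ‖∑ k, B k (y k)‖ ∂π
  set m₂ := ∫ y, ‖∑ k, B k (y k)‖ ^ 2 ∂π
  have hm₁ : normMoment P (model Z₀ Z) 1 = ENNReal.ofReal m₁ := by
    rw [normMoment_eq_ofReal hZm hind hZi hZ0 hr.le hae]; simp only [pow_one]; rfl
  have hm₂ : normMoment P (model Z₀ Z) 2 = ENNReal.ofReal m₂ :=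
    normMoment_eq_ofReal hZm hind hZi hZ0 hr.le hae 2
  rw [threshold_eq_ofReal hr.le (integral_nonneg fun _ => norm_nonneg _)
    (integral_nonneg fun _ => sq_nonneg _) hz (by linarith) hR hm₁ hm₂]
  set τ := deviation σ r m₁ m₂ z.im x
  have hτ : 0 < τ := deviation_pos hσ hr hz (by linarith)
  set U := complexify u
  set V := complexify v
  -- Since `Re(-i w) = Im w`, the imaginary part of the entry is the real part for the rotated unit
  -- vector, so the real-part estimate applies to both.
  set V' : EuclideanSpace ℂ (Fin N) := (-Complex.I) • V
  have hU : ‖U‖ = 1 := (norm_complexify u).trans hu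
  have hV : ‖V‖ = 1 := (norm_complexify v).trans hv
  have hV' : ‖V'‖ = 1 := by rw [norm_smul, hV]; simp
  have tail : ∀ w : EuclideanSpace ℂ (Fin N), ‖w‖ = 1 →
      P.real {ω | τ ^ 2 / 2 ≤ (resolvRe U w z Z₀ B (fun k => Z k ω)
        - ∫ y, resolvRe U w z Z₀ B y ∂π) ^ 2} ≤ Real.exp (-(1 / 8192) * x) := by
    intro w hw
    have bf : BddMeas fun y => resolvRe U w z Z₀ B y - ∫ y, resolvRe U w z Z₀ B y ∂π :=
      (bddMeas_resolvRe h₀ hBm hBh hz U w).sub (BddMeas.const _)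
    refine measureReal_sq_ge_le (bf.comp hY.measurable) hσ hr hz (fun p => ?_) hx
    rw [measurePreserving_integral_comp hY (f := fun y => (resolvRe U w z Z₀ B y
      - ∫ y, resolvRe U w z Z₀ B y ∂π) ^ (2 * (p + 1))) (bf.pow _).1]
    exact integral_resolvRe_pow_le h₀ hBm hBh hr.le hBr hB0 hz hU hw hσ hs p
  have hentry : ∀ᵐ ω ∂P, resolventEntry u v z (model Z₀ Z ω)
      = (resolvRe U V z Z₀ B (fun k => Z k ω) : ℂ)
        + (resolvRe U V' z Z₀ B (fun k => Z k ω) : ℂ) * Complex.I := by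
    filter_upwards [hae] with ω hω
    have e : model Z₀ Z ω = Z₀ + ∑ k, B k (Z k ω) := by simp only [model, B, hω]
    rw [resolventEntry_eq, e]
    simp only [resolvRe, V', map_smul, inner_smul_right]
    refine Complex.ext ?_ ?_ <;> simp [U, V]
  have b1 := (bddMeas_resolvRe h₀ hBm hBh hz U V).comp hY.measurable
  have b2 := (bddMeas_resolvRe h₀ hBm hBh hz U V').comp hY.measurable
  have hint : ∫ ω', resolventEntry u v z (model Z₀ Z ω') ∂P
      = ((∫ y, resolvRe U V z Z₀ B y ∂π : ℝ) : ℂ)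
        + ((∫ y, resolvRe U V' z Z₀ B y ∂π : ℝ) : ℂ) * Complex.I := by
    rw [integral_congr_ae hentry, integral_add (b1.integrable P).ofReal
      ((b2.integrable P).ofReal.mul_const _), integral_mul_const, integral_complex_ofReal,
      integral_complex_ofReal,
      measurePreserving_integral_comp hY (bddMeas_resolvRe h₀ hBm hBh hz U V).1,
      measurePreserving_integral_comp hY (bddMeas_resolvRe h₀ hBm hBh hz U V').1]
  rw [hint]
  set S : EuclideanSpace ℂ (Fin N) → Set Ω := fun w =>
    {ω | τ ^ 2 / 2 ≤ (resolvRe U w z Z₀ B (fun k => Z k ω)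
        - ∫ y, resolvRe U w z Z₀ B y ∂π) ^ 2}
  -- If the squared modulus is at least `τ²`, then one of the two squared parts is at least `τ² /
  -- 2`.
  have hsub : P {ω | ENNReal.ofReal τ ≤ ENNReal.ofReal ‖resolventEntry u v z (model Z₀ Z ω)
      - (((∫ y, resolvRe U V z Z₀ B y ∂π : ℝ) : ℂ)
        + ((∫ y, resolvRe U V' z Z₀ B y ∂π : ℝ) : ℂ) * Complex.I)‖} ≤ P (S V ∪ S V') := by
    refine measure_mono_ae ?_
    filter_upwards [hentry] with ω hω hmem
    change ENNReal.ofReal τ ≤ _ at hmem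
    rw [ENNReal.ofReal_le_ofReal_iff (norm_nonneg _), hω] at hmem
    have h2 := pow_le_pow_left₀ hτ.le hmem 2
    rw [Complex.sq_norm, Complex.normSq_apply] at h2
    simp only [Complex.sub_re, Complex.add_re, Complex.ofReal_re, Complex.mul_re, Complex.I_re,
      mul_zero, Complex.ofReal_im, Complex.I_im, sub_self, add_zero, Complex.sub_im,
      Complex.add_im, Complex.mul_im, mul_one, zero_add] at h2
    by_contra hno
    have h3 : ¬ (τ ^ 2 / 2 ≤ (resolvRe U V z Z₀ B (fun k => Z k ω)
        - ∫ y, resolvRe U V z Z₀ B y ∂π) ^ 2) := fun h => hno (Or.inl h)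
    have h4 : ¬ (τ ^ 2 / 2 ≤ (resolvRe U V' z Z₀ B (fun k => Z k ω)
        - ∫ y, resolvRe U V' z Z₀ B y ∂π) ^ 2) := fun h => hno (Or.inr h)
    rw [not_le] at h3 h4
    linarith
  refine hsub.trans ((measure_union_le _ _).trans ?_)
  rw [two_mul, ENNReal.ofReal_add (Real.exp_pos _).le (Real.exp_pos _).le]
  refine add_le_add ?_ ?_
  · rw [← ofReal_measureReal]
    exact ENNReal.ofReal_le_ofReal (tail V hV)
  · rw [← ofReal_measureReal]
    exact ENNReal.ofReal_le_ofReal (tail V' hV')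

end Transfer

end RandomMatrix

theorem mainTheorem7 :
    ∃ C : ℝ, 0 < C ∧
      ∀ (N n : ℕ) (Ω : Type*) [MeasurableSpace Ω] (P : Measure Ω) [IsProbabilityMeasure P]
        (Z₀ : Matrix (Fin N) (Fin N) ℂ) (Z : Fin n → Ω → Matrix (Fin N) (Fin N) ℂ),
        Z₀.IsHermitian →
        (∀ k, Measurable (Z k)) →
        (∀ k, ∀ᵐ ω ∂P, (Z k ω).IsHermitian) →
        iIndepFun Z P →
        (∀ k i j, Integrable (fun ω => Z k ω i j) P) →
        (∀ k, RandomMatrix.expect P (Z k) = 0) →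
        (∃ k, ¬ ∀ᵐ ω ∂P, Z k ω = 0) →
        ∀ z : ℂ, 0 < z.im →
        ∀ u v : EuclideanSpace ℝ (Fin N), ‖u‖ = 1 → ‖v‖ = 1 →
        ∀ x : ℝ, 0 ≤ x →
          P {ω | RandomMatrix.threshold P Z₀ Z z.im x ≤
              ENNReal.ofReal
                ‖RandomMatrix.resolventEntry u v z (RandomMatrix.model Z₀ Z ω)
                  - ∫ ω', RandomMatrix.resolventEntry u v z (RandomMatrix.model Z₀ Z ω') ∂P‖}
            ≤ ENNReal.ofReal (2 * Real.exp (-C * x)) := by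
  refine ⟨1 / 8192, by norm_num, ?_⟩
  intro N n Ω _ P _ Z₀ Z h₀ hZm hZh hind hZi hZ0 hne z hz u v hu hv x hx
  rcases lt_or_ge x 4096 with hx' | hx'
  -- For `x < 4096` the bound is trivial: `2 exp(-x / 8192) ≥ 2 (1 - x / 8192) > 1`.
  · refine prob_le_one.trans ?_
    rw [← ENNReal.ofReal_one]
    refine ENNReal.ofReal_le_ofReal ?_
    have := Real.add_one_le_exp (-(1 / 8192) * x)
    linarith
  · by_cases hR : RandomMatrix.R P Z = ∞
    · rw [RandomMatrix.threshold_eq_top (by linarith) hR]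
      simp
    · have hR' : RandomMatrix.R P Z = ENNReal.ofReal (RandomMatrix.R P Z).toReal :=
        (ENNReal.ofReal_toReal hR).symm
      -- If `R = 0`, every `Z k` vanishes almost surely, which is excluded. Positivity of `R` makes
      -- the threshold positive, as needed to divide in Markov's inequality.
      have hr : 0 < (RandomMatrix.R P Z).toReal := by
        refine lt_of_le_of_ne ENNReal.toReal_nonneg fun h => ?_
        obtain ⟨k, hk⟩ := hne
        refine hk ?_
        rw [← h, ENNReal.ofReal_zero] at hR'
        have h1 : ∀ᵐ ω ∂P, (⨆ k, ‖Z k ω‖ₑ) ≤ 0 := by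
          rw [← hR']; exact ENNReal.ae_le_essSup _
        filter_upwards [h1] with ω hω
        have h2 : ‖Z k ω‖ₑ ≤ 0 := (le_iSup (fun k => ‖Z k ω‖ₑ) k).trans hω
        simpa using h2
      exact RandomMatrix.measure_deviation_le h₀ hZm hZh hind hZi hZ0 hr hR' hz hu hv hx'
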